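/- Let $n\ge 1$, $m\ge 0$, $0<s<1$, $1\le p<\infty$ with $sp<n$, and let $F\subset\mathbb R^m$ be an arbitrary set. Let $\Omega,\omega\subset\mathbb R^n$ be smooth bounded open sets (not necessarily connected) with $\overline\Omega\subset\omega$. For $A\subset\mathbb R^n$, let $W^{s,p}(A;F)$ be the set of measurable $u:A\to\mathbb R^m$ with $u(x)\in F$ for a.e. $x\in A$ and $$\|u\|_{W^{s,p}(A)}=\|u\|_{L^p(A)}+\Big(\int_A\int_A\frac{|u(x)-u(y)|^p}{|x-y|^{n+sp}}\,dx\,dy\Big)^{1/p}<\infty .$$ A *finite mesh* $\mathscr C$ is given by $T\in\mathbb R^n$, $\varepsilon>0$ and finitely many of the closed cubes $T+2\varepsilon K+[-\varepsilon,\varepsilon]^n$, $K\in\mathbb Z^n$; we also write $\mathscr C$ for their union. Its $\ell$-skeleton is the union of all $\ell$-dimensional faces of these cubes ($0\le \ell\le n$). Let $0\le\ell<n$. A map $h$ on the $(\ell+1)$-skeleton is a *homogeneous extension* of a map $g$ on the $\ell$-skeleton if, on each $(\ell+1)$-dimensional face with center $z$, $$h(x)=g\Big(z+\varepsilon\,\frac{x-z}{|x-z|_\infty}\Big)\quad\text{for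 all } x\ne z$$ (no condition is imposed on $h(z)$). For $0\le j\le n-1$, a map $h:\mathscr C\to\mathbb R^m$ is *piecewise $j$-homogeneous* if it is obtained from its own restriction to the $j$-skeleton by $n-j$ successive homogeneous extensions, from the $\ell$-skeleton to the $(\ell+1)$-skeleton for $\ell=j,\dots,n-1$. **Theorem.** Let $f\in W^{s,p}(\omega;F)$ and let $j$ be an integer with $[sp]\le j\le n-1$, where $[sp]$ is the integer part of $sp$. Then there exist finite meshes $\mathscr C^k$ and maps $f_k:\mathscr C^k\to F$, $k\in\mathbb N$, such that $\overline\Omega\subset\mathscr C^k\subset\omega$ for every $k$ and a) each $f_k$ is piecewise $j$-homogeneous on $\mathscr C^k$; b) each $f_k$ belongs to $W^{s,p}(\mathscr C^k;F)$; c) $\|f_k-f\|_{W^{s,p}(\Omega)}\to 0$ as $k\to\infty$. -/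

import Mathlib

open Set Filter Topology MeasureTheory
open scoped ENNReal

/-- An open set of class `C^∞` (no connectedness is required): near each boundary point it is a
strict sublevel set of a smooth function with non-vanishing differential at that point. -/
def IsSmoothOpen {E : Type*} [NormedAddCommGroup E] [NormedSpace ℝ E] (U : Set E) : Prop :=
  IsOpen U ∧ ∀ x ∈ frontier U, ∃ V ∈ 𝓝 x, ∃ φ : E → ℝ,
    ContDiff ℝ ((⊤ : ℕ∞) : WithTop ℕ∞) φ ∧ fderiv ℝ φ x ≠ 0 ∧ ∀ y ∈ V, (y ∈ U ↔ φ y < 0)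

/-- The Gagliardo energy
`|f|_{W^{s,p}(A)}^p = ∫_A ∫_A |f(x) - f(y)|^p / |x - y|^{n + sp} dx dy`, for `A ⊆ ℝⁿ`.
The norm of `x - y` is the sup norm of `ℝⁿ = (Fin n → ℝ)`; replacing it by the Euclidean norm
changes the energy only by a factor between two positive constants depending on `n, s, p`. -/
noncomputable def gagliardoEnergy {n m : ℕ} (s p : ℝ) (A : Set (Fin n → ℝ))
    (f : (Fin n → ℝ) → EuclideanSpace ℝ (Fin m)) : ℝ≥0∞ :=
  ∫⁻ x in A, ∫⁻ y in A, ‖f x - f y‖ₑ ^ p / ‖x - y‖ₑ ^ ((n : ℝ) + s * p)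

/-- The norm of `W^{s,p}(A)` (with value `∞` allowed):
the `L^p` norm plus the Gagliardo seminorm. Only the values of `f` on `A` matter. -/
noncomputable def sobolevNorm {n m : ℕ} (s p : ℝ) (A : Set (Fin n → ℝ))
    (f : (Fin n → ℝ) → EuclideanSpace ℝ (Fin m)) : ℝ≥0∞ :=
  eLpNorm f (ENNReal.ofReal p) (volume.restrict A) + gagliardoEnergy s p A f ^ (1 / p)

/-- `f ∈ W^{s,p}(A ; F)`: `f` is measurable on `A`, its `W^{s,p}(A)` norm is finite, and `f` takes
values in `F` almost everywhere on `A`. -/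
def MemSobolev {n m : ℕ} (s p : ℝ) (A : Set (Fin n → ℝ)) (F : Set (EuclideanSpace ℝ (Fin m)))
    (f : (Fin n → ℝ) → EuclideanSpace ℝ (Fin m)) : Prop :=
  AEStronglyMeasurable f (volume.restrict A) ∧ sobolevNorm s p A f < ∞ ∧
    ∀ᵐ x ∂volume.restrict A, f x ∈ F

/-- A finite mesh in `ℝⁿ`: finitely many cubes `T + 2εK + [-ε, ε]ⁿ`, `K ∈ ℤⁿ`, of the horizontal
mesh of size `2ε` having `T` as one of its centers. -/
structure CubicMesh (n : ℕ) where
  T : Fin n → ℝ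
  ε : ℝ
  ε_pos : 0 < ε
  cubes : Finset (Fin n → ℤ)

namespace CubicMesh

variable {n : ℕ}

/-- The faces of the cube with index `K` are described by a vector of signs `σ`: the coordinates
with `σ i = 0` are free, while the others are frozen at the end point `± ε` (relative to the
center of the cube) given by `σ i`. This is the center of that face. -/
noncomputable def faceCenter (C : CubicMesh n) (K : Fin n → ℤ) (σ : Fin n → SignType) :
    Fin n → ℝ :=
  fun i => C.T i + 2 * C.ε * (K i : ℝ) + C.ε * ((σ i : SignType) : ℝ)

/-- The closed face of the cube with index `K` described by `σ`. -/
def face (C : CubicMesh n) (K : Fin n → ℤ) (σ : Fin n → SignType) : Set (Fin n → ℝ) :=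
  {x | ∀ i, |x i - C.faceCenter K σ i| ≤ C.ε ∧ (σ i ≠ 0 → x i = C.faceCenter K σ i)}

/-- The dimension of the faces described by `σ`: the number of free coordinates. -/
def faceDim (σ : Fin n → SignType) : ℕ := (Finset.univ.filter fun i => σ i = 0).card

/-- The `l`-dimensional skeleton: the union of the `l`-dimensional faces of the cubes. -/
def skeleton (C : CubicMesh n) (l : ℕ) : Set (Fin n → ℝ) :=
  {x | ∃ K ∈ C.cubes, ∃ σ : Fin n → SignType, faceDim σ = l ∧ x ∈ C.face K σ}

/-- The mesh as a subset of `ℝⁿ`: the union of its closed cubes. -/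
def carrier (C : CubicMesh n) : Set (Fin n → ℝ) :=
  {x | ∃ K ∈ C.cubes, ∀ i, |x i - (C.T i + 2 * C.ε * (K i : ℝ))| ≤ C.ε}

/-- `h` is, on the `l`-skeleton, the homogeneous extension of `g` from the `(l-1)`-skeleton: on each
`l`-dimensional face with center `z`, `h(x) = g (z + ε (x - z) / |x - z|)`, where `| |` is the sup
norm. The argument of `g` is the radial projection of `x` onto the relative boundary of the face;
as it is undefined at `x = z`, the value `h(z)` is not prescribed. -/
def IsHomogeneousStep {α : Type*} (C : CubicMesh n) (l : ℕ) (g h : (Fin n → ℝ) → α) : Prop :=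
  ∀ K ∈ C.cubes, ∀ σ : Fin n → SignType, faceDim σ = l → ∀ x ∈ C.face K σ,
    x ≠ C.faceCenter K σ →
      h x = g (C.faceCenter K σ + (C.ε / ‖x - C.faceCenter K σ‖) • (x - C.faceCenter K σ))

/-- `h` is, on the mesh, the `j`-homogeneous extension of the restriction of `g` to the
`j`-skeleton: it is obtained from `G j = g` by the `n - j` successive homogeneous extensions
`G (l + 1)` of `G l` from the `l`-skeleton to the `(l + 1)`-skeleton, `j ≤ l < n`. -/
def IsHomogeneousExtension {α : Type*} (C : CubicMesh n) (j : ℕ) (g h : (Fin n → ℝ) → α) :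
    Prop :=
  ∃ G : ℕ → (Fin n → ℝ) → α, EqOn (G j) g (C.skeleton j) ∧
    (∀ l, j ≤ l → l < n → C.IsHomogeneousStep (l + 1) (G l) (G (l + 1))) ∧
    EqOn (G n) h C.carrier

/-- `h` is piecewise `j`-homogeneous on the mesh: it is the `j`-homogeneous extension of its own
restriction to the `j`-skeleton. -/
def IsPiecewiseHomogeneous {α : Type*} (C : CubicMesh n) (j : ℕ) (h : (Fin n → ℝ) → α) : Prop :=
  C.IsHomogeneousExtension j h h

end CubicMesh

/-!
Project `ω` onto the `j`-skeleton of a mesh of side `δ` by successive radial projections. In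
coordinates centered at the cubes of the unit mesh the projection `P` is explicit: with `r` the
`(j+1)`-st smallest distance of a coordinate to `ℤ`, every coordinate is pushed away from its
nearest integer by the factor `1 / (2 r)`, but at most to the nearest half-integer. As `P` is
constant along the rays issued from the centers of the faces of dimension greater than `j`, the
map `f ∘ P` is piecewise `j`-homogeneous.

At a point with parameter `r` the map `P` is `1 / r`-Lipschitz, so composition with `P` magnifies
the energy density by at most a multiple of `r ^ (-s p)`, which is integrable on the unit cube
because `s p < j + 1`. Averaging over the translations of the mesh, one of them makes the
near-diagonal energy of `f ∘ P` and the rescaled `L^p` norm of `f ∘ P - f` at most a constant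
times the energy of `f` over the pairs of points at distance less than `4 δ`, and this tends to
`0` with `δ`.
-/

open Module

section PushOut

/-- The map of the line which expands the interval of radius `r` around each integer `k` to
`[k - 1/2, k + 1/2]` and sends the remaining points to the nearest half-integer. Integers are fixed
also for `r = 0`, as `0 / 0 = 0`. -/
noncomputable def pushOut (r t : ℝ) : ℝ :=
  round t + (t - round t) / (2 * max r |t - round t|)

theorem pushOut_add_intCast (r t : ℝ) (k : ℤ) : pushOut r (t + k) = pushOut r t + k := by
  simp only [pushOut, round_add_intCast, Int.cast_add, add_sub_add_right_eq_sub]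
  ring

theorem eq_round_or_abs_sub_eq_half {t : ℝ} {k : ℤ} (h : |t - k| ≤ 1 / 2) :
    k = round t ∨ |t - k| = 1 / 2 ∧ |t - round t| = 1 / 2 := by
  refine or_iff_not_imp_left.2 fun hk => ?_
  have hone : (1 : ℝ) ≤ |(k : ℝ) - round t| := by
    exact_mod_cast Int.one_le_abs (sub_ne_zero.2 hk)
  have htri := abs_sub_le (k : ℝ) t (round t)
  rw [abs_sub_comm (k : ℝ) t] at htri
  have hround := abs_sub_round t
  constructor <;> linarith

theorem norm_coe_unitAddCircle_eq {t : ℝ} {k : ℤ} (h : |t - k| ≤ 1 / 2) :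
    ‖(t : UnitAddCircle)‖ = |t - k| := by
  rw [UnitAddCircle.norm_eq]
  rcases eq_round_or_abs_sub_eq_half h with rfl | ⟨hk, hround⟩
  exacts [rfl, hround.trans hk.symm]

theorem norm_coe_unitAddCircle_le_half (t : ℝ) : ‖(t : UnitAddCircle)‖ ≤ 1 / 2 := by
  rw [UnitAddCircle.norm_eq]
  exact abs_sub_round t

theorem pushOut_eq {r t : ℝ} {k : ℤ} (hr : r ≤ 1 / 2) (h : |t - k| ≤ 1 / 2) :
    pushOut r t = k + (t - k) / (2 * max r |t - k|) := by
  rcases eq_round_or_abs_sub_eq_half h with rfl | ⟨hk, hround⟩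
  · rfl
  · rw [pushOut, hk, hround, max_eq_right hr]
    ring

theorem pushOut_eq_self {r t : ℝ} {k : ℤ} (hr : r ≤ 1 / 2) (h : |t - k| = 1 / 2) :
    pushOut r t = t := by
  rw [pushOut_eq hr h.le, h, max_eq_right hr]
  ring

theorem abs_pushOut_sub_self_le {r : ℝ} (hr : r ≤ 1 / 2) (t : ℝ) : |pushOut r t - t| ≤ 1 / 2 := by
  set s := t - round t with hs
  have hsM : |s| ≤ max r |s| := le_max_right _ _
  have hM : max r |s| ≤ 1 / 2 := max_le hr (abs_sub_round t)
  rcases (abs_nonneg s).eq_or_lt with h0 | h0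
  · rw [pushOut, ← hs, abs_eq_zero.1 h0.symm, zero_div, add_zero, abs_sub_comm, ← hs, ← h0]
    norm_num
  · have : 0 < max r |s| := h0.trans_le hsM
    have hdiff : pushOut r t - t = s * ((1 - 2 * max r |s|) / (2 * max r |s|)) := by
      rw [pushOut, ← hs]
      field_simp
      rw [hs]
      ring
    have hnum : 0 ≤ 1 - 2 * max r |s| := by linarith
    rw [hdiff, abs_mul, abs_of_nonneg (div_nonneg hnum (by positivity)), ← mul_div_assoc,
      div_le_iff₀ (by positivity)]
    nlinarith

theorem div_two_mul_max_abs {r : ℝ} (hr : 0 < r) (s : ℝ) :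
    s / (2 * max r |s|) = max (-(1 / 2)) (min (1 / 2) (s / (2 * r))) := by
  have hr2 : 0 < 2 * r := by positivity
  rcases le_total |s| r with h | h
  · obtain ⟨hl, hu⟩ := abs_le.1 h
    rw [max_eq_left h, min_eq_right, max_eq_right]
    · rw [le_div_iff₀ hr2]; linarith
    · rw [div_le_iff₀ hr2]; linarith
  rw [max_eq_right h]
  rcases le_abs.1 h with hs | hs
  · have hs0 : 0 < s := hr.trans_le hs
    rw [abs_of_pos hs0, min_eq_left, max_eq_right (by norm_num)]
    · field_simp
    · rw [le_div_iff₀ hr2]; linarith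
  · have hs0 : s < 0 := by linarith
    rw [abs_of_neg hs0, min_eq_right, max_eq_left]
    · field_simp [hs0.ne]
    · rw [div_le_iff₀ hr2]; linarith
    · rw [div_le_iff₀ hr2]; linarith

theorem abs_pushOut_sub_le_of_same_cell {r : ℝ} (hr : 0 < r) (hr2 : r ≤ 1 / 2) {t t' : ℝ} {k : ℤ}
    (ht : |t - k| ≤ 1 / 2) (ht' : |t' - k| ≤ 1 / 2) :
    |pushOut r t - pushOut r t'| ≤ |t - t'| / (2 * r) := by
  rw [pushOut_eq hr2 ht, pushOut_eq hr2 ht', add_sub_add_left_eq_sub, div_two_mul_max_abs hr,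
    div_two_mul_max_abs hr, max_comm, max_comm (-(1 / 2))]
  refine (abs_max_sub_max_le_abs _ _ _).trans ?_
  rw [min_comm, min_comm (1 / 2)]
  refine (abs_min_sub_min_le_max _ _ _ _).trans_eq ?_
  rw [sub_self, abs_zero, max_eq_left (abs_nonneg _), ← sub_div, sub_sub_sub_cancel_right, abs_div,
    abs_of_pos (by positivity : 0 < 2 * r)]

theorem abs_pushOut_sub_le {r : ℝ} (hr : 0 < r) (hr2 : r ≤ 1 / 2) (t t' : ℝ) :
    |pushOut r t - pushOut r t'| ≤ |t - t'| / (2 * r) := by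
  wlog h : t ≤ t' generalizing t t'
  · rw [abs_sub_comm, abs_sub_comm t]
    exact this t' t (le_of_not_ge h)
  have hround : round t ≤ round t' := by
    simp only [round_eq]
    gcongr
  rcases hround.eq_or_lt with hk | hk
  · exact abs_pushOut_sub_le_of_same_cell hr hr2 (abs_sub_round t) (hk ▸ abs_sub_round t')
  -- The half-integers `a ≤ b` next to `t` and `t'` are fixed points lying between `t` and `t'`.
  have hk' : (round t : ℝ) + 1 ≤ round t' := by exact_mod_cast hk
  obtain ⟨-, hta⟩ := abs_le.1 (abs_sub_round t)
  obtain ⟨hbt, -⟩ := abs_le.1 (abs_sub_round t')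
  set a : ℝ := round t + 1 / 2 with ha
  set b : ℝ := round t' - 1 / 2 with hb
  have ha2 : |a - round t| = 1 / 2 := by rw [ha, add_sub_cancel_left]; norm_num
  have hb2 : |b - round t'| = 1 / 2 := by rw [hb, sub_sub_cancel_left]; norm_num
  have hPa := abs_pushOut_sub_le_of_same_cell hr hr2 (abs_sub_round t) ha2.le
  have hPb := abs_pushOut_sub_le_of_same_cell hr hr2 hb2.le (abs_sub_round t')
  rw [pushOut_eq_self hr2 ha2, abs_sub_comm t a, abs_of_nonneg (by linarith : 0 ≤ a - t)] at hPa
  rw [pushOut_eq_self hr2 hb2, abs_sub_comm b t', abs_of_nonneg (by linarith : 0 ≤ t' - b)] at hPb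
  have hab : |a - b| ≤ (b - a) / (2 * r) := by
    rw [abs_sub_comm, abs_of_nonneg (by linarith), le_div_iff₀ (by positivity)]
    nlinarith
  rw [abs_sub_comm t t', abs_of_nonneg (sub_nonneg.2 h)]
  calc |pushOut r t - pushOut r t'|
      ≤ |pushOut r t - a| + |a - b| + |b - pushOut r t'| :=
        (abs_sub_le _ b _).trans (by gcongr; exact abs_sub_le _ _ _)
    _ ≤ (a - t) / (2 * r) + (b - a) / (2 * r) + (t' - b) / (2 * r) := by gcongr
    _ = (t' - t) / (2 * r) := by ring

theorem abs_pushOut_radius_sub_le {r : ℝ} (hr : 0 < r) (r' t : ℝ) :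
    |pushOut r t - pushOut r' t| ≤ |r - r'| / (2 * r) := by
  rcases eq_or_ne (t - round t) 0 with h0 | h0
  · simp only [pushOut, h0, zero_div, sub_self, abs_zero]
    positivity
  simp only [pushOut, add_sub_add_left_eq_sub]
  set s := t - round t
  have : 0 < max r |s| := hr.trans_le (le_max_left _ _)
  have hM' : 0 < max r' |s| := (abs_pos.2 h0).trans_le (le_max_right _ _)
  have hfactor : s / (2 * max r |s|) - s / (2 * max r' |s|) =
      s / max r' |s| * ((max r' |s| - max r |s|) / (2 * max r |s|)) := by
    field_simp
  have hle : |(s / max r' |s|)| ≤ 1 := by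
    rw [abs_div, abs_of_pos hM', div_le_one hM']
    exact le_max_right _ _
  rw [hfactor, abs_mul, abs_div (max r' |s| - _), abs_of_pos (by positivity : 0 < 2 * max r |s|),
    abs_sub_comm r, ← one_mul (|r' - r| / _)]
  refine mul_le_mul hle (div_le_div₀ (abs_nonneg _) (abs_max_sub_max_le_abs r' r |s|) ?_ ?_)
    (by positivity) zero_le_one
  · positivity
  · gcongr
    exact le_max_left _ _

theorem measurable_pushOut : Measurable fun a : ℝ × ℝ => pushOut a.1 a.2 := by
  have hround : Measurable fun a : ℝ × ℝ => (round a.2 : ℝ) := by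
    simp only [round_eq]
    fun_prop
  unfold pushOut
  fun_prop

end PushOut

section OrderStat

variable {ι N : Type*} [SeminormedAddCommGroup N] {j : ℕ} {c : ℝ}

/-- The `(j+1)`-st smallest norm of an entry of a vector (`0` if there are at most `j` entries). -/
noncomputable def orderStat (j : ℕ) (d : ι → N) : ℝ :=
  ⨅ e : Fin (j + 1) ↪ ι, ‖d ∘ e‖

theorem orderStat_nonneg (j : ℕ) (d : ι → N) : 0 ≤ orderStat j d :=
  Real.iInf_nonneg fun _ => norm_nonneg _

variable [Finite ι]

theorem orderStat_le_norm_comp (d : ι → N) (e : Fin (j + 1) ↪ ι) : orderStat j d ≤ ‖d ∘ e‖ :=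
  ciInf_le (Set.finite_range _).bddBelow e

theorem exists_orderStat_eq [Nonempty (Fin (j + 1) ↪ ι)] (d : ι → N) :
    ∃ e : Fin (j + 1) ↪ ι, ‖d ∘ e‖ = orderStat j d :=
  exists_eq_ciInf_of_finite

theorem orderStat_le_of_forall_le (hc : 0 ≤ c) {d : ι → N} (hd : ∀ i, ‖d i‖ ≤ c) :
    orderStat j d ≤ c := by
  cases isEmpty_or_nonempty (Fin (j + 1) ↪ ι) with
  | inl h => exact (Real.iInf_of_isEmpty _).trans_le hc
  | inr h =>
    obtain ⟨e⟩ := h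
    exact (orderStat_le_norm_comp d e).trans <| (pi_norm_le_iff_of_nonneg hc).2 fun _ => hd _

theorem abs_orderStat_sub_le {ι : Type*} [Fintype ι] (d d' : ι → N) :
    |orderStat j d - orderStat j d'| ≤ ‖d - d'‖ := by
  cases isEmpty_or_nonempty (Fin (j + 1) ↪ ι) with
  | inl h => simp [orderStat, Real.iInf_of_isEmpty]
  | inr h =>
    have hle : ∀ a b : ι → N, orderStat j a - orderStat j b ≤ ‖a - b‖ := fun a b => by
      obtain ⟨e, he⟩ := exists_orderStat_eq (j := j) b
      have hcomp : ‖a ∘ e - b ∘ e‖ ≤ ‖a - b‖ :=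
        (pi_norm_le_iff_of_nonneg (norm_nonneg _)).2 fun i => norm_le_pi_norm (a - b) (e i)
      linarith [orderStat_le_norm_comp a e, norm_sub_norm_le (a ∘ e) (b ∘ e)]
    exact abs_sub_le_iff.2 ⟨hle d d', (hle d' d).trans_eq (norm_sub_rev _ _)⟩

theorem exists_orderStat_eq_mem {d : ι → N} (hd : ∀ i, ‖d i‖ ≤ c) {I : Finset ι} (hI : j < I.card)
    (hdI : ∀ i ∉ I, ‖d i‖ = c) :
    ∃ e : Fin (j + 1) ↪ ι, (∀ i, e i ∈ I) ∧ ‖d ∘ e‖ ≤ orderStat j d := by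
  let g : Fin (j + 1) ↪ ι :=
    (Fin.castLEEmb hI).trans (I.equivFin.symm.toEmbedding.trans (.subtype _))
  have hg : ∀ i, g i ∈ I := fun i => (I.equivFin.symm _).2
  have : Nonempty (Fin (j + 1) ↪ ι) := ⟨g⟩
  obtain ⟨e, he⟩ := exists_orderStat_eq (j := j) d
  by_cases h : ∀ i, e i ∈ I
  · exact ⟨e, h, he.le⟩
  push Not at h
  obtain ⟨i, hi⟩ := h
  have hc : c ≤ orderStat j d := by
    rw [← he, ← hdI _ hi]
    exact norm_le_pi_norm (d ∘ e) i
  exact ⟨g, hg, le_trans ((pi_norm_le_iff_of_nonneg ((norm_nonneg _).trans (hd (e i)))).2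
    fun _ => hd _) hc⟩

theorem orderStat_le_mul {N' : Type*} [SeminormedAddCommGroup N'] {d : ι → N} {d' : ι → N'}
    {t : ℝ} (ht : 0 ≤ t) (hd : ∀ i, ‖d i‖ ≤ c) {I : Finset ι} (hI : j < I.card)
    (hdI : ∀ i ∉ I, ‖d i‖ = c) (hd' : ∀ i ∈ I, ‖d' i‖ ≤ t * ‖d i‖) :
    orderStat j d' ≤ t * orderStat j d := by
  obtain ⟨e, he, hle⟩ := exists_orderStat_eq_mem hd hI hdI
  calc orderStat j d' ≤ ‖d' ∘ e‖ := orderStat_le_norm_comp d' e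
    _ ≤ t * ‖d ∘ e‖ := (pi_norm_le_iff_of_nonneg (by positivity)).2 fun i =>
        (hd' _ (he i)).trans (by gcongr; exact norm_le_pi_norm (d ∘ e) i)
    _ ≤ t * orderStat j d := by gcongr

end OrderStat

section CellRetraction

variable {ι : Type*} {j : ℕ}

/-- The `(j+1)`-st smallest distance of a coordinate to the integers. It is positive away from the
dual skeleton of dimension `card ι - j - 1`. -/
noncomputable def cellRadius (j : ℕ) (z : ι → ℝ) : ℝ :=
  orderStat j fun i => (z i : UnitAddCircle)

/-- The retraction of `ℝⁿ`, away from the dual skeleton, onto the `j`-skeleton of the mesh of unit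
cubes centered at the points of `ℤⁿ`: the composition of the successive radial projections from the
`(l+1)`-skeleton onto the `l`-skeleton, `l ≥ j`. -/
noncomputable def cellRetraction (j : ℕ) (z : ι → ℝ) : ι → ℝ :=
  fun i => pushOut (cellRadius j z) (z i)

theorem cellRadius_nonneg (j : ℕ) (z : ι → ℝ) : 0 ≤ cellRadius j z := orderStat_nonneg _ _

theorem cellRadius_add_intCast (j : ℕ) (z : ι → ℝ) (k : ι → ℤ) :
    cellRadius j (z + fun i => (k i : ℝ)) = cellRadius j z := by
  simp [cellRadius]

theorem cellRetraction_add_intCast (j : ℕ) (z : ι → ℝ) (k : ι → ℤ) :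
    cellRetraction j (z + fun i => (k i : ℝ)) = cellRetraction j z + fun i => (k i : ℝ) := by
  ext i
  simp only [cellRetraction, cellRadius_add_intCast, Pi.add_apply, pushOut_add_intCast]

theorem cellRadius_le_half [Finite ι] (j : ℕ) (z : ι → ℝ) : cellRadius j z ≤ 1 / 2 :=
  orderStat_le_of_forall_le one_half_pos.le fun _ => norm_coe_unitAddCircle_le_half _

theorem cellRadius_scale [Finite ι] {z z' : ι → ℝ} {k : ι → ℤ} {I : Finset ι}
    (hI : j < I.card) {t : ℝ} (ht : 0 < t) (hz : ∀ i, |z i - k i| ≤ 1 / 2)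
    (hz' : ∀ i, |z' i - k i| ≤ 1 / 2) (hzI : ∀ i ∉ I, |z i - k i| = 1 / 2)
    (hzz' : ∀ i ∉ I, z' i = z i) (hzt : ∀ i ∈ I, z' i - k i = t * (z i - k i)) :
    cellRadius j z' = t * cellRadius j z := by
  have hscale : ∀ i ∈ I, ‖(z' i : UnitAddCircle)‖ = t * ‖(z i : UnitAddCircle)‖ := fun i hi => by
    rw [norm_coe_unitAddCircle_eq (hz i), norm_coe_unitAddCircle_eq (hz' i), hzt i hi, abs_mul,
      abs_of_pos ht]
  have hmax : ∀ i ∉ I, ‖(z i : UnitAddCircle)‖ = 1 / 2 := fun i hi => by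
    rw [norm_coe_unitAddCircle_eq (hz i), hzI i hi]
  refine le_antisymm (orderStat_le_mul ht.le (fun _ => norm_coe_unitAddCircle_le_half _) hI hmax
    fun i hi => (hscale i hi).le) ?_
  rw [← le_inv_mul_iff₀ ht]
  refine orderStat_le_mul (inv_nonneg.2 ht.le) (fun _ => norm_coe_unitAddCircle_le_half _) hI
    (fun i hi => by rw [hzz' i hi, hmax i hi]) fun i hi => ?_
  rw [hscale i hi, inv_mul_cancel_left₀ ht.ne']

theorem cellRetraction_scale [Finite ι] {z z' : ι → ℝ} {k : ι → ℤ} {I : Finset ι}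
    (hI : j < I.card) {t : ℝ} (ht : 0 < t) (hz : ∀ i, |z i - k i| ≤ 1 / 2)
    (hz' : ∀ i, |z' i - k i| ≤ 1 / 2) (hzI : ∀ i ∉ I, |z i - k i| = 1 / 2)
    (hzz' : ∀ i ∉ I, z' i = z i) (hzt : ∀ i ∈ I, z' i - k i = t * (z i - k i)) :
    cellRetraction j z' = cellRetraction j z := by
  have hr := cellRadius_le_half j z
  have hr' := cellRadius_le_half j z'
  ext i
  simp only [cellRetraction]
  by_cases hi : i ∈ I
  · rw [pushOut_eq hr (hz i), pushOut_eq hr' (hz' i), hzt i hi,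
      cellRadius_scale hI ht hz hz' hzI hzz' hzt, abs_mul, abs_of_pos ht,
      ← mul_max_of_nonneg _ _ ht.le, mul_left_comm, mul_div_mul_left _ _ ht.ne']
  · rw [hzz' i hi, pushOut_eq_self hr (hzI i hi), pushOut_eq_self hr' (hzI i hi)]

variable [Fintype ι]

theorem abs_cellRadius_sub_le (z z' : ι → ℝ) : |cellRadius j z - cellRadius j z'| ≤ ‖z - z'‖ :=
  (abs_orderStat_sub_le _ _).trans <| (pi_norm_le_iff_of_nonneg (norm_nonneg _)).2 fun i =>
    calc ‖(z i : UnitAddCircle) - z' i‖ = ‖((z i - z' i : ℝ) : UnitAddCircle)‖ := rfl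
      _ ≤ ‖z i - z' i‖ := QuotientAddGroup.norm_mk_le_norm
      _ ≤ ‖z - z'‖ := norm_le_pi_norm (z - z') i

theorem norm_cellRetraction_sub_self_le (z : ι → ℝ) : ‖cellRetraction j z - z‖ ≤ 1 / 2 :=
  (pi_norm_le_iff_of_nonneg one_half_pos.le).2 fun i =>
    abs_pushOut_sub_self_le (cellRadius_le_half j z) (z i)

theorem norm_cellRetraction_sub_le {z : ι → ℝ} (hz : 0 < cellRadius j z) (z' : ι → ℝ) :
    ‖cellRetraction j z' - cellRetraction j z‖ ≤ ‖z' - z‖ / cellRadius j z := by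
  refine (pi_norm_le_iff_of_nonneg (by positivity)).2 fun i => ?_
  have hradius : |cellRadius j z - cellRadius j z'| ≤ ‖z' - z‖ :=
    (abs_cellRadius_sub_le z z').trans_eq (norm_sub_rev _ _)
  have hcoord : |z' i - z i| ≤ ‖z' - z‖ := norm_le_pi_norm (z' - z) i
  set r := cellRadius j z
  set r' := cellRadius j z'
  calc |pushOut r' (z' i) - pushOut r (z i)|
      ≤ |pushOut r' (z' i) - pushOut r (z' i)| + |pushOut r (z' i) - pushOut r (z i)| :=
        abs_sub_le _ _ _
    _ ≤ |r - r'| / (2 * r) + |z' i - z i| / (2 * r) := by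
        rw [abs_sub_comm (pushOut r' _)]
        exact add_le_add (abs_pushOut_radius_sub_le hz r' (z' i))
          (abs_pushOut_sub_le hz (cellRadius_le_half j z) (z' i) (z i))
    _ ≤ ‖z' - z‖ / (2 * r) + ‖z' - z‖ / (2 * r) := by gcongr
    _ = ‖z' - z‖ / r := by ring

theorem measurable_cellRadius {ι : Type*} [Finite ι] (j : ℕ) :
    Measurable (cellRadius j : (ι → ℝ) → ℝ) := by
  cases nonempty_fintype ι
  exact (LipschitzWith.of_dist_le_mul (K := 1) fun x y => by
    simpa [dist_eq_norm] using abs_cellRadius_sub_le x y).continuous.measurable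

theorem measurable_cellRetraction {ι : Type*} [Finite ι] (j : ℕ) :
    Measurable (cellRetraction j : (ι → ℝ) → ι → ℝ) :=
  measurable_pi_lambda _ fun i =>
    measurable_pushOut.comp ((measurable_cellRadius j).prodMk (measurable_pi_apply i))

end CellRetraction

section UnitBox

variable {ι : Type*} [Fintype ι] {j : ℕ}

/-- The half-open unit box of `ℝⁿ`, over which translations of a unit mesh are averaged. -/
def unitBox (ι : Type*) : Set (ι → ℝ) := univ.pi fun _ => Ico 0 1

theorem restrict_unitBox :
    volume.restrict (unitBox ι) =
      Measure.pi fun _ : ι => (volume : Measure ℝ).restrict (Ico 0 1) := by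
  rw [unitBox, volume_pi, Measure.restrict_pi_pi]

instance isProbabilityMeasure_restrict_Ico_zero_one :
    IsProbabilityMeasure ((volume : Measure ℝ).restrict (Ico 0 1)) :=
  ⟨by simp⟩

instance isProbabilityMeasure_restrict_unitBox :
    IsProbabilityMeasure (volume.restrict (unitBox ι)) := by
  rw [restrict_unitBox]
  infer_instance

open scoped Pointwise in
theorem setLIntegral_unitBox_add {g : (ι → ℝ) → ℝ≥0∞}
    (hg : ∀ k : ι → ℤ, Function.Periodic g fun i => (k i : ℝ)) (a : ι → ℝ) :
    ∫⁻ τ in unitBox ι, g (a + τ) = ∫⁻ z in unitBox ι, g z := by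
  let b := Pi.basisFun ℝ ι
  have hbox : IsAddFundamentalDomain (Submodule.span ℤ (Set.range b)) (unitBox ι) volume := by
    rw [unitBox, ← ZSpan.fundamentalDomain_pi_basisFun]
    exact ZSpan.isAddFundamentalDomain b volume
  have hinv : ∀ (v : Submodule.span ℤ (Set.range b)) (x : ι → ℝ), g (v +ᵥ x) = g x := by
    rintro ⟨v, hv⟩ x
    choose k hk using (Module.Basis.mem_span_iff_repr_mem ℤ b v).1 hv
    have hvk : v = fun i => (k i : ℝ) := funext fun i => (hk i).symm
    change g (v + x) = g x
    rw [add_comm, hvk, hg k x]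
  have : VAddInvariantMeasure (Submodule.span ℤ (Set.range b)) (ι → ℝ) volume :=
    ⟨fun v s _ => measure_preimage_add volume (v : ι → ℝ) s⟩
  rw [← (hbox.vadd_of_comm a).setLIntegral_eq hbox g hinv,
    ← (measurePreserving_add_left volume a).setLIntegral_comp_preimage_emb
      (measurableEmbedding_addLeft a) g (a +ᵥ unitBox ι)]
  congr 2
  ext τ
  exact vadd_mem_vadd_set_iff.symm

theorem lintegral_pi_prod {α : ι → Type*} [∀ i, MeasurableSpace (α i)] (μ : ∀ i, Measure (α i))
    [∀ i, IsProbabilityMeasure (μ i)] {f : ∀ i, α i → ℝ≥0∞} (hf : ∀ i, Measurable (f i)) :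
    ∫⁻ z, ∏ i, f i (z i) ∂Measure.pi μ = ∏ i, ∫⁻ t, f i t ∂μ i := by
  rw [ProbabilityTheory.lintegral_prod_eq_prod_lintegral_of_indepFun _ _
    (ProbabilityTheory.iIndepFun_pi fun i => (hf i).aemeasurable)
    fun i => (hf i).comp (measurable_pi_apply i)]
  exact Finset.prod_congr rfl fun i _ => (measurePreserving_eval μ i).lintegral_comp (hf i)

theorem setLIntegral_Ioo_ofReal_rpow_neg_lt_top {b : ℝ} (hb : b < 1) :
    ∫⁻ t in Ioo (0 : ℝ) 1, ENNReal.ofReal t ^ (-b) < ∞ := by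
  have hint : IntegrableOn (fun t : ℝ => t ^ (-b)) (Ioo 0 1) :=
    (intervalIntegral.intervalIntegrable_rpow' (by linarith)).1.mono_set Ioo_subset_Ioc_self
  refine (setLIntegral_mono' measurableSet_Ioo fun t ht => ?_).trans_lt hint.lintegral_lt_top
  rw [ENNReal.ofReal_rpow_of_pos ht.1]

theorem measurable_enorm_unitAddCircle : Measurable fun t : ℝ => ‖(t : UnitAddCircle)‖ₑ :=
  (AddCircle.continuous_mk' 1).enorm.measurable

theorem setLIntegral_enorm_unitAddCircle_rpow_neg_lt_top {b : ℝ} (hb : b < 1) :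
    ∫⁻ t in Ico (0 : ℝ) 1, ‖(t : UnitAddCircle)‖ₑ ^ (-b) < ∞ := by
  have hreflect : ∫⁻ t in Ioo (0 : ℝ) 1, ENNReal.ofReal (1 - t) ^ (-b) =
      ∫⁻ t in Ioo (0 : ℝ) 1, ENNReal.ofReal t ^ (-b) := by
    have := (Measure.measurePreserving_sub_left volume (1 : ℝ)).setLIntegral_comp_preimage
      measurableSet_Ioo (f := fun t => ENNReal.ofReal t ^ (-b)) (s := Ioo 0 1) (by fun_prop)
    simpa using this
  rw [← setLIntegral_congr Ioo_ae_eq_Ico]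
  calc ∫⁻ t in Ioo (0 : ℝ) 1, ‖(t : UnitAddCircle)‖ₑ ^ (-b)
      ≤ ∫⁻ t in Ioo (0 : ℝ) 1, (ENNReal.ofReal t ^ (-b) + ENNReal.ofReal (1 - t) ^ (-b)) := by
        refine setLIntegral_mono' measurableSet_Ioo fun t ht => ?_
        rw [← ofReal_norm, UnitAddCircle.norm_eq, abs_sub_round_eq_min,
          Int.fract_eq_self.2 ⟨ht.1.le, ht.2⟩]
        rcases min_choice t (1 - t) with h | h <;> rw [h]
        exacts [le_self_add, le_add_self]
    _ < ∞ := by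
        rw [lintegral_add_left (by fun_prop), hreflect, ← two_mul]
        exact ENNReal.mul_lt_top ENNReal.ofNat_lt_top (setLIntegral_Ioo_ofReal_rpow_neg_lt_top hb)

theorem ofReal_cellRadius_rpow_neg_le (hj : j < Fintype.card ι) {a : ℝ} (ha : 0 ≤ a) (z : ι → ℝ) :
    ENNReal.ofReal (cellRadius j z) ^ (-a) ≤
      ∏ i, ‖(z i : UnitAddCircle)‖ₑ ^ (-(a / ((j : ℝ) + 1))) := by
  have : Nonempty (Fin (j + 1) ↪ ι) :=
    Function.Embedding.nonempty_of_card_le (by simpa using hj)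
  obtain ⟨e, he⟩ := exists_orderStat_eq (j := j) fun i => (z i : UnitAddCircle)
  set b := a / ((j : ℝ) + 1) with hb
  have hb0 : 0 ≤ b := by positivity
  have hanti : Antitone fun x : ℝ≥0∞ => x ^ (-b) := fun x y h => by
    simpa only [ENNReal.rpow_neg, ENNReal.inv_le_inv] using ENNReal.rpow_le_rpow h hb0
  -- The radius bounds the `j + 1` smallest distances to the integers, and the others are `≤ 1`.
  calc ENNReal.ofReal (cellRadius j z) ^ (-a)
      = ∏ _i : Fin (j + 1), ENNReal.ofReal (cellRadius j z) ^ (-b) := by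
        rw [Finset.prod_const, Finset.card_univ, Fintype.card_fin, ← ENNReal.rpow_natCast,
          ← ENNReal.rpow_mul, hb]
        congr 1
        push_cast
        field_simp
    _ ≤ ∏ i : Fin (j + 1), ‖(z (e i) : UnitAddCircle)‖ₑ ^ (-b) := by
        refine Finset.prod_le_prod' fun i _ => hanti ?_
        rw [cellRadius, ← he, ← ofReal_norm]
        exact ENNReal.ofReal_le_ofReal
          (norm_le_pi_norm ((fun i => (z i : UnitAddCircle)) ∘ e) i)
    _ = ∏ i ∈ Finset.univ.map e, ‖(z i : UnitAddCircle)‖ₑ ^ (-b) := by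
        rw [Finset.prod_map]
    _ ≤ ∏ i, ‖(z i : UnitAddCircle)‖ₑ ^ (-b) := by
        refine Finset.prod_le_prod_of_subset_of_one_le' (Finset.subset_univ _) fun i _ _ => ?_
        have hle : ‖(z i : UnitAddCircle)‖ₑ ≤ 1 := by
          rw [← ofReal_norm, ENNReal.ofReal_le_one]
          linarith [norm_coe_unitAddCircle_le_half (z i)]
        simpa only [ENNReal.one_rpow] using hanti hle

theorem setLIntegral_cellRadius_rpow_neg_lt_top (hj : j < Fintype.card ι) {a : ℝ} (ha : 0 ≤ a)
    (haj : a < (j : ℝ) + 1) :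
    ∫⁻ z in unitBox ι, ENNReal.ofReal (cellRadius j z) ^ (-a) < ∞ := by
  refine (lintegral_mono fun z => ofReal_cellRadius_rpow_neg_le hj ha z).trans_lt ?_
  rw [restrict_unitBox, lintegral_pi_prod _ fun _ => measurable_enorm_unitAddCircle.pow_const _]
  exact ENNReal.prod_lt_top fun _ _ =>
    setLIntegral_enorm_unitAddCircle_rpow_neg_lt_top ((div_lt_one (by positivity)).2 haj)

theorem ae_cellRadius_pos (hj : j < Fintype.card ι) :
    ∀ᵐ z ∂volume.restrict (unitBox ι), 0 < cellRadius j z := by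
  have hfin := ae_lt_top ((measurable_cellRadius j).ennreal_ofReal.pow_const (-(1 / 2 : ℝ)))
    (setLIntegral_cellRadius_rpow_neg_lt_top hj one_half_pos.le
      (one_half_lt_one.trans_le (le_add_of_nonneg_left j.cast_nonneg))).ne
  filter_upwards [hfin] with z hz
  refine (cellRadius_nonneg j z).lt_of_ne fun h0 => ?_
  simp [← h0] at hz

end UnitBox

section Kernel

theorem ofReal_rpow_neg_mul_setLIntegral_ball_le {E : Type*} [NormedAddCommGroup E]
    [MeasurableSpace E] [BorelSpace E] (μ : Measure E) {D : E → ℝ≥0∞} (hD : Measurable D) {d : ℝ}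
    (hd : 0 ≤ d) (a R : ℝ) :
    ENNReal.ofReal (min a R) ^ (-d) * ∫⁻ k in Metric.ball 0 (min a R), D k ∂μ ≤
      ∫⁻ k in Metric.ball 0 R, {k | ‖k‖ ≤ a}.indicator (fun k => ‖k‖ₑ ^ (-d) * D k) k ∂μ := by
  have hball : MeasurableSet {k : E | ‖k‖ ≤ a} := measurableSet_le (by fun_prop) (by fun_prop)
  rw [← lintegral_const_mul _ hD, setLIntegral_indicator hball]
  refine (setLIntegral_mono' measurableSet_ball fun k hk => ?_).trans
    (lintegral_mono_set fun k hk => ?_)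
  · gcongr ?_ * _
    rw [ENNReal.rpow_neg, ENNReal.rpow_neg, ENNReal.inv_le_inv, ← ofReal_norm]
    gcongr
    exact (mem_ball_zero_iff.1 hk).le
  · rw [mem_ball_zero_iff, lt_min_iff] at hk
    exact ⟨hk.1.le, mem_ball_zero_iff.2 hk.2⟩

variable {E : Type*} [NormedAddCommGroup E] [NormedSpace ℝ E] [FiniteDimensional ℝ E]
  [MeasurableSpace E] [BorelSpace E] (μ : Measure E) [μ.IsAddHaarMeasure]

theorem lintegral_comp_smul {a : ℝ} (ha : 0 < a) (g : E → ℝ≥0∞) :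
    ∫⁻ h, g (a • h) ∂μ = ENNReal.ofReal a ^ (-(finrank ℝ E : ℝ)) * ∫⁻ h, g h ∂μ := by
  rw [← (measurableEmbedding_const_smul₀ ha.ne').lintegral_map, Measure.map_addHaar_smul _ ha.ne',
    lintegral_smul_measure, smul_eq_mul, abs_of_pos (by positivity),
    ENNReal.ofReal_inv_of_pos (by positivity), ENNReal.ofReal_pow ha.le, ENNReal.rpow_neg,
    ENNReal.rpow_natCast]

/-- The integral of the singular kernel `‖h‖ ^ (-q)` outside the ball of radius `a`. -/
noncomputable def kernelTail (q a : ℝ) : ℝ≥0∞ :=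
  ∫⁻ h in {h : E | a ≤ ‖h‖}, ‖h‖ₑ ^ (-q) ∂μ

theorem kernelTail_eq (q : ℝ) {a : ℝ} (ha : 0 < a) :
    kernelTail μ q a = ENNReal.ofReal a ^ ((finrank ℝ E : ℝ) - q) * kernelTail μ q 1 := by
  have hA0 : ENNReal.ofReal a ≠ 0 := by simpa using ha
  have hA1 : ENNReal.ofReal a ≠ ∞ := ENNReal.ofReal_ne_top
  have hball (b : ℝ) : MeasurableSet {h : E | b ≤ ‖h‖} :=
    measurableSet_le (by fun_prop) (by fun_prop)
  have hscale (h : E) : {h : E | a ≤ ‖h‖}.indicator (fun h => ‖h‖ₑ ^ (-q)) (a • h) =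
      ENNReal.ofReal a ^ (-q) * {h : E | 1 ≤ ‖h‖}.indicator (fun h => ‖h‖ₑ ^ (-q)) h := by
    simp only [indicator_apply, mem_ofPred_eq, norm_smul, Real.norm_of_nonneg ha.le,
      le_mul_iff_one_le_right ha, mul_ite, mul_zero]
    rw [enorm_smul, Real.enorm_of_nonneg ha.le, ENNReal.mul_rpow_of_ne_top hA1 enorm_ne_top]
  have hsmul := lintegral_comp_smul μ ha ({h : E | a ≤ ‖h‖}.indicator fun h => ‖h‖ₑ ^ (-q))
  simp only [hscale] at hsmul
  rw [lintegral_const_mul _ (by measurability), lintegral_indicator (hball 1),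
    lintegral_indicator (hball a)] at hsmul
  rw [kernelTail, kernelTail, sub_eq_add_neg, ENNReal.rpow_add _ _ hA0 hA1, mul_assoc, hsmul,
    ← mul_assoc, ← ENNReal.rpow_add _ _ hA0 hA1, add_neg_cancel, ENNReal.rpow_zero, one_mul]

theorem kernelTail_one_lt_top {q : ℝ} (hq : (finrank ℝ E : ℝ) < q) : kernelTail μ q 1 < ∞ := by
  have hq0 : 0 < q := (Nat.cast_nonneg _).trans_lt hq
  refine lt_of_le_of_lt ?_ ((integrable_one_add_norm (μ := μ) hq).const_mul
    ((2 : ℝ) ^ q)).lintegral_lt_top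
  refine (setLIntegral_mono' (measurableSet_le measurable_const measurable_norm)
    fun h (h1 : 1 ≤ ‖h‖) => ?_).trans (setLIntegral_le_lintegral _ _)
  have h0 : 0 < ‖h‖ := one_pos.trans_le h1
  rw [← ofReal_norm, ENNReal.ofReal_rpow_of_pos h0]
  refine ENNReal.ofReal_le_ofReal ?_
  calc ‖h‖ ^ (-q) = 2 ^ q * (2 * ‖h‖) ^ (-q) := by
        rw [Real.mul_rpow two_pos.le h0.le, ← mul_assoc, ← Real.rpow_add two_pos, add_neg_cancel,
          Real.rpow_zero, one_mul]
    _ ≤ 2 ^ q * (1 + ‖h‖) ^ (-q) := by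
        gcongr 2 ^ q * ?_
        exact Real.rpow_le_rpow_of_nonpos (by positivity) (by linarith) (neg_nonpos.2 hq0.le)

theorem lintegral_rpow_neg_mul_setLIntegral_indicator {q L : ℝ} (hL : 0 < L) (S : Set E)
    {f : E → ℝ≥0∞} (hf : Measurable f) :
    ∫⁻ h, ‖h‖ₑ ^ (-q) * ∫⁻ k in S, {k | ‖k‖ ≤ L * ‖h‖}.indicator f k ∂μ ∂μ =
      ∫⁻ k in S, f k * kernelTail μ q (L⁻¹ * ‖k‖) ∂μ := by
  have hset : MeasurableSet {a : E × E | ‖a.2‖ ≤ L * ‖a.1‖} :=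
    measurableSet_le (by fun_prop) (by fun_prop)
  have hswap (h k : E) : ‖h‖ₑ ^ (-q) * {k | ‖k‖ ≤ L * ‖h‖}.indicator f k =
      f k * {h | L⁻¹ * ‖k‖ ≤ ‖h‖}.indicator (fun h => ‖h‖ₑ ^ (-q)) h := by
    simp only [indicator_apply, mem_ofPred_eq, inv_mul_le_iff₀ hL, mul_ite, mul_zero, mul_comm]
  have hjoint : Measurable fun a : E × E => ‖a.1‖ₑ ^ (-q) * {k | ‖k‖ ≤ L * ‖a.1‖}.indicator f a.2 :=
    Measurable.mul (by fun_prop) ((hf.comp measurable_snd).indicator hset)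
  calc _ = ∫⁻ h, ∫⁻ k in S, ‖h‖ₑ ^ (-q) * {k | ‖k‖ ≤ L * ‖h‖}.indicator f k ∂μ ∂μ := by
        refine lintegral_congr fun h => (lintegral_const_mul _ (hf.indicator ?_)).symm
        exact measurableSet_le (by fun_prop) (by fun_prop)
    _ = ∫⁻ k in S, ∫⁻ h, ‖h‖ₑ ^ (-q) * {k | ‖k‖ ≤ L * ‖h‖}.indicator f k ∂μ ∂μ :=
        lintegral_lintegral_swap hjoint.aemeasurable
    _ = _ := by
        have hball (b : ℝ) : MeasurableSet {h : E | b ≤ ‖h‖} :=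
          measurableSet_le (by fun_prop) (by fun_prop)
        simp only [hswap]
        refine lintegral_congr fun k => ?_
        rw [lintegral_const_mul _ (Measurable.indicator (by fun_prop) (hball _)),
          lintegral_indicator (hball _), kernelTail]

theorem lintegral_rpow_neg_mul_ball_average_le [Nontrivial E] {D : E → ℝ≥0∞} (hD : Measurable D)
    (q : ℝ) {L : ℝ} (hL : 0 < L) (R : ℝ) :
    ∫⁻ h, ‖h‖ₑ ^ (-q) * (ENNReal.ofReal (min (L * ‖h‖) R) ^ (-(finrank ℝ E : ℝ)) *
        ∫⁻ k in Metric.ball 0 (min (L * ‖h‖) R), D k ∂μ) ∂μ ≤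
      kernelTail μ q 1 * ENNReal.ofReal L ^ (q - finrank ℝ E) *
        ∫⁻ k in Metric.ball 0 R, D k * ‖k‖ₑ ^ (-q) ∂μ := by
  set d : ℝ := (finrank ℝ E : ℝ)
  have htail (k : E) (hk : k ≠ 0) : ‖k‖ₑ ^ (-d) * kernelTail μ q (L⁻¹ * ‖k‖) =
      kernelTail μ q 1 * ENNReal.ofReal L ^ (q - d) * ‖k‖ₑ ^ (-q) := by
    have hk0 : ‖k‖ₑ ≠ 0 := by simpa using hk
    rw [kernelTail_eq μ q (by positivity), ENNReal.ofReal_mul (by positivity), ofReal_norm,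
      ENNReal.mul_rpow_of_ne_top ENNReal.ofReal_ne_top enorm_ne_top,
      ENNReal.ofReal_inv_of_pos hL, ENNReal.inv_rpow, ← ENNReal.rpow_neg, neg_sub,
      show -q = -d + (d - q) by ring, ENNReal.rpow_add _ _ hk0 enorm_ne_top]
    ring
  calc _ ≤ ∫⁻ h, ‖h‖ₑ ^ (-q) * ∫⁻ k in Metric.ball 0 R,
          {k | ‖k‖ ≤ L * ‖h‖}.indicator (fun k => ‖k‖ₑ ^ (-d) * D k) k ∂μ ∂μ := by
        gcongr with h
        exact ofReal_rpow_neg_mul_setLIntegral_ball_le μ hD (Nat.cast_nonneg _) _ R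
    _ = ∫⁻ k in Metric.ball 0 R, ‖k‖ₑ ^ (-d) * D k * kernelTail μ q (L⁻¹ * ‖k‖) ∂μ :=
        lintegral_rpow_neg_mul_setLIntegral_indicator μ hL _ (by fun_prop)
    _ = ∫⁻ k in Metric.ball 0 R,
          kernelTail μ q 1 * ENNReal.ofReal L ^ (q - d) * (D k * ‖k‖ₑ ^ (-q)) ∂μ := by
        refine lintegral_congr_ae ?_
        filter_upwards [ae_restrict_of_ae (μ.ae_ne 0)] with k hk
        rw [mul_right_comm, htail k hk]
        ring
    _ = _ := lintegral_const_mul _ (by fun_prop)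

end Kernel

section Increments

variable {E : Type*} [NormedAddCommGroup E] [MeasurableSpace E]

/-- The total size of the increments `W x (x + k)` with step `k` of a two-point function `W`. -/
noncomputable def totalIncrement (μ : Measure E) (W : E → E → ℝ≥0∞) (k : E) : ℝ≥0∞ :=
  ∫⁻ x, W x (x + k) ∂μ

/-- The part of the energy `∫ ∫ W x y ‖y - x‖ ^ (-q) dy dx` of a two-point function `W` that comes
from the pairs with `x ∈ A` and `‖y - x‖ < R`. -/
noncomputable def nearEnergy (μ : Measure E) (q R : ℝ) (A : Set E) (W : E → E → ℝ≥0∞) : ℝ≥0∞ :=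
  ∫⁻ x in A, ∫⁻ h in Metric.ball 0 R, W x (x + h) * ‖h‖ₑ ^ (-q) ∂μ ∂μ

/-- The triangle inequality for a two-point function `W`, up to the factor `M` and for intermediate
points in `U` only. -/
def QuasiTriangle (M : ℝ≥0∞) (U : Set E) (W : E → E → ℝ≥0∞) : Prop :=
  ∀ ⦃x y v⦄, v ∈ U → W x y ≤ M * (W x v + W v y)

variable {μ : Measure E} {W : E → E → ℝ≥0∞}

theorem nearEnergy_mono_radius (q : ℝ) {R R' : ℝ} (h : R ≤ R') (A : Set E) :
    nearEnergy μ q R A W ≤ nearEnergy μ q R' A W :=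
  lintegral_mono fun _ => lintegral_mono_set (Metric.ball_subset_ball h)

theorem nearEnergy_const_mul {M : ℝ≥0∞} (hM : M ≠ ∞) (q R : ℝ) (A : Set E) (W : E → E → ℝ≥0∞) :
    nearEnergy μ q R A (fun x y => M * W x y) = M * nearEnergy μ q R A W := by
  simp only [nearEnergy, mul_assoc, lintegral_const_mul' _ _ hM]

variable [BorelSpace E]

theorem setLIntegral_ball_comp_sub_left_le [μ.IsAddLeftInvariant] [μ.IsNegInvariant] (D : E → ℝ≥0∞)
    {c : E} {ρ : ℝ} (hc : 2 * ‖c‖ ≤ ρ) :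
    ∫⁻ w in Metric.ball 0 (ρ / 2), D (c - w) ∂μ ≤ ∫⁻ k in Metric.ball 0 ρ, D k ∂μ := by
  rw [← lintegral_indicator measurableSet_ball, ← lintegral_indicator measurableSet_ball,
    ← lintegral_sub_left_eq_self (μ := μ) ((Metric.ball 0 ρ).indicator D) c]
  refine lintegral_mono fun w => indicator_apply_le' (fun hw => ?_) fun _ => zero_le
  rw [indicator_of_mem]
  rw [mem_ball_zero_iff] at hw ⊢
  linarith [norm_sub_le c w]

theorem setLIntegral_add_le_totalIncrement [μ.IsAddLeftInvariant]
    (hW : Measurable (Function.uncurry W)) {M : ℝ≥0∞}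
    {U A : Set E} (htri : QuasiTriangle M U W) (hA : MeasurableSet A) (a b : E) {w : E}
    (hAU : ∀ x ∈ A, x + a + w ∈ U) :
    ∫⁻ x in A, W (x + a) (x + b) ∂μ ≤
      M * (totalIncrement μ W w + totalIncrement μ W (b - a - w)) := by
  have hleft : totalIncrement μ W w = ∫⁻ x, W (x + a) (x + a + w) ∂μ :=
    (lintegral_add_right_eq_self (fun x => W x (x + w)) a).symm
  have hright : totalIncrement μ W (b - a - w) = ∫⁻ x, W (x + a + w) (x + b) ∂μ := by
    rw [totalIncrement, ← lintegral_add_right_eq_self _ (a + w)]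
    exact lintegral_congr fun x => by congr 1 <;> abel
  rw [hleft, hright, ← lintegral_add_left (by fun_prop), ← lintegral_const_mul _ (by fun_prop)]
  exact (setLIntegral_mono' hA fun x hx => htri (hAU x hx)).trans (setLIntegral_le_lintegral A _)

variable [SecondCountableTopology E]

theorem measurable_totalIncrement [SFinite μ] (hW : Measurable (Function.uncurry W)) :
    Measurable (totalIncrement μ W) :=
  (show Measurable fun a : E × E => W a.2 (a.2 + a.1) by fun_prop).lintegral_prod_right

theorem nearEnergy_eq [SFinite μ] (hW : Measurable (Function.uncurry W)) (q R : ℝ) (A : Set E) :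
    nearEnergy μ q R A W =
      ∫⁻ h in Metric.ball 0 R, (∫⁻ x in A, W x (x + h) ∂μ) * ‖h‖ₑ ^ (-q) ∂μ := by
  have hjoint : Measurable fun a : E × E => W a.1 (a.1 + a.2) * ‖a.2‖ₑ ^ (-q) := by
    fun_prop
  rw [nearEnergy, lintegral_lintegral_swap hjoint.aemeasurable]
  exact lintegral_congr fun h => lintegral_mul_const _ (by fun_prop)

theorem nearEnergy_add [SFinite μ] (hW : Measurable (Function.uncurry W)) (q R : ℝ) (A : Set E)
    (W' : E → E → ℝ≥0∞) :
    nearEnergy μ q R A (fun x y => W x y + W' x y) =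
      nearEnergy μ q R A W + nearEnergy μ q R A W' := by
  rw [nearEnergy, nearEnergy, nearEnergy,
    ← lintegral_add_left (Measurable.lintegral_prod_right (by fun_prop))]
  refine lintegral_congr fun x => ?_
  rw [← lintegral_add_left (by fun_prop)]
  simp only [add_mul]

theorem nearEnergy_univ_eq [SFinite μ] (hW : Measurable (Function.uncurry W)) (q R : ℝ) :
    nearEnergy μ q R univ W =
      ∫⁻ k in Metric.ball 0 R, totalIncrement μ W k * ‖k‖ₑ ^ (-q) ∂μ := by
  simp only [nearEnergy_eq hW, Measure.restrict_univ, totalIncrement]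

end Increments

section IncrementEstimates

variable {E : Type*} [NormedAddCommGroup E] [NormedSpace ℝ E] [FiniteDimensional ℝ E]
  [Nontrivial E] [MeasurableSpace E] [BorelSpace E] {μ : Measure E} [μ.IsAddHaarMeasure]
  {W : E → E → ℝ≥0∞} {M : ℝ≥0∞} {U A : Set E}

/-- Averaging the triangle inequality over the intermediate points `x + a + w` with `‖w‖ < ρ / 2`
trades the single increment with step `b - a` for all increments with steps shorter than `ρ`. -/
theorem setLIntegral_increment_le (hW : Measurable (Function.uncurry W))
    (htri : QuasiTriangle M U W) (hA : MeasurableSet A) {a b : E} {ρ : ℝ} (hρ : 0 < ρ)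
    (hab : 2 * ‖b - a‖ ≤ ρ) (hAU : ∀ x ∈ A, ∀ w, 2 * ‖w‖ < ρ → x + a + w ∈ U) :
    ∫⁻ x in A, W (x + a) (x + b) ∂μ ≤
      2 * M / μ (Metric.ball 0 (1 / 2)) * (ENNReal.ofReal ρ ^ (-(finrank ℝ E : ℝ)) *
        ∫⁻ k in Metric.ball 0 ρ, totalIncrement μ W k ∂μ) := by
  set I := ∫⁻ k in Metric.ball 0 ρ, totalIncrement μ W k ∂μ
  have hD : Measurable (totalIncrement μ W) := measurable_totalIncrement hW
  have hstep : ∀ w ∈ Metric.ball (0 : E) (ρ / 2), ∫⁻ x in A, W (x + a) (x + b) ∂μ ≤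
      M * (totalIncrement μ W w + totalIncrement μ W (b - a - w)) := fun w hw =>
    setLIntegral_add_le_totalIncrement hW htri hA a b fun x hx => hAU x hx w <| by
      linarith [mem_ball_zero_iff.1 hw]
  have havg : (∫⁻ x in A, W (x + a) (x + b) ∂μ) * μ (Metric.ball 0 (ρ / 2)) ≤ 2 * M * I := by
    calc _ = ∫⁻ _w in Metric.ball 0 (ρ / 2), ∫⁻ x in A, W (x + a) (x + b) ∂μ ∂μ :=
          (setLIntegral_const _ _).symm
      _ ≤ ∫⁻ w in Metric.ball 0 (ρ / 2),
            M * (totalIncrement μ W w + totalIncrement μ W (b - a - w)) ∂μ :=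
          setLIntegral_mono' measurableSet_ball hstep
      _ = M * ((∫⁻ w in Metric.ball 0 (ρ / 2), totalIncrement μ W w ∂μ) +
            ∫⁻ w in Metric.ball 0 (ρ / 2), totalIncrement μ W (b - a - w) ∂μ) := by
          rw [lintegral_const_mul _ (by fun_prop), lintegral_add_left hD]
      _ ≤ M * (I + I) := by
          gcongr
          · exact lintegral_mono_set (Metric.ball_subset_ball (by linarith))
          · exact setLIntegral_ball_comp_sub_left_le _ hab
      _ = 2 * M * I := by ring
  have hvol : μ (Metric.ball (0 : E) (ρ / 2)) =
      μ (Metric.ball 0 (1 / 2)) * ENNReal.ofReal ρ ^ (finrank ℝ E : ℝ) := by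
    rw [div_eq_mul_one_div, Measure.addHaar_ball_mul _ _ hρ.le, ENNReal.rpow_natCast,
      ENNReal.ofReal_pow hρ.le, mul_comm]
  have hball0 : μ (Metric.ball (0 : E) (ρ / 2)) ≠ 0 :=
    (Metric.measure_ball_pos _ _ (half_pos hρ)).ne'
  refine ((ENNReal.le_div_iff_mul_le (.inl hball0) (.inl measure_ball_ne_top)).2 havg).trans_eq ?_
  rw [hvol, div_eq_mul_inv, div_eq_mul_inv (2 * M), ENNReal.rpow_neg,
    ENNReal.mul_inv (.inr (by simp)) (.inl measure_ball_ne_top)]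
  ring

theorem setLIntegral_ball_totalIncrement_le (hW : Measurable (Function.uncurry W)) {q : ℝ}
    (hq : 0 ≤ q) (R : ℝ) :
    ∫⁻ k in Metric.ball 0 R, totalIncrement μ W k ∂μ ≤
      ENNReal.ofReal R ^ q * nearEnergy μ q R univ W := by
  rw [nearEnergy_univ_eq hW,
    ← lintegral_const_mul' _ _ (ENNReal.rpow_ne_top_of_nonneg hq ENNReal.ofReal_ne_top)]
  refine lintegral_mono_ae ?_
  filter_upwards [ae_restrict_of_ae (μ.ae_ne 0), ae_restrict_mem measurableSet_ball] with k hk hkR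
  calc totalIncrement μ W k = ‖k‖ₑ ^ q * (totalIncrement μ W k * ‖k‖ₑ ^ (-q)) := by
        rw [mul_left_comm, ← ENNReal.rpow_add _ _ (by simpa using hk) enorm_ne_top, add_neg_cancel,
          ENNReal.rpow_zero, mul_one]
    _ ≤ _ := by
        gcongr
        rw [← ofReal_norm]
        exact ENNReal.ofReal_le_ofReal (mem_ball_zero_iff.1 hkR).le

theorem setLIntegral_increment_le_nearEnergy (hW : Measurable (Function.uncurry W))
    (htri : QuasiTriangle M U W) (hA : MeasurableSet A) {b : E} {q ρ : ℝ} (hq : 0 ≤ q) (hρ : 0 < ρ)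
    (hb : 2 * ‖b‖ ≤ ρ) (hAU : ∀ x ∈ A, ∀ w, 2 * ‖w‖ < ρ → x + w ∈ U) :
    ∫⁻ x in A, W x (x + b) ∂μ ≤ 2 * M / μ (Metric.ball 0 (1 / 2)) *
      (ENNReal.ofReal ρ ^ (q - finrank ℝ E) * nearEnergy μ q ρ univ W) := by
  calc ∫⁻ x in A, W x (x + b) ∂μ = ∫⁻ x in A, W (x + 0) (x + b) ∂μ := by simp only [add_zero]
    _ ≤ 2 * M / μ (Metric.ball 0 (1 / 2)) * (ENNReal.ofReal ρ ^ (-(finrank ℝ E : ℝ)) *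
          (ENNReal.ofReal ρ ^ q * nearEnergy μ q ρ univ W)) := by
        refine (setLIntegral_increment_le hW htri hA hρ (by simpa using hb)
          (by simpa using hAU)).trans ?_
        gcongr
        exact setLIntegral_ball_totalIncrement_le hW hq ρ
    _ = _ := by
        rw [sub_eq_neg_add, ENNReal.rpow_add _ _ (by simpa using hρ) ENNReal.ofReal_ne_top,
          mul_assoc]

/-- With `x + v h` the image of `x + h`, this is how the energy transforms under a map which is only
assumed to be `L / 2`-Lipschitz at the point `x` itself. -/
theorem setLIntegral_dilated_increment_le (hW : Measurable (Function.uncurry W))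
    (htri : QuasiTriangle M U W) (hM : M ≠ ∞) (hA : MeasurableSet A) (q : ℝ) {L R : ℝ} (hL : 0 < L)
    (hR : 0 < R) {a : E} {v : E → E} {S : Set E} (hS : MeasurableSet S)
    (hv : ∀ h ∈ S, 2 * ‖v h - a‖ ≤ min (L * ‖h‖) R)
    (hAU : ∀ x ∈ A, ∀ w, 2 * ‖w‖ < R → x + a + w ∈ U) :
    ∫⁻ h in S, (∫⁻ x in A, W (x + a) (x + v h) ∂μ) * ‖h‖ₑ ^ (-q) ∂μ ≤
      2 * M / μ (Metric.ball 0 (1 / 2)) * (kernelTail μ q 1 *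
        ENNReal.ofReal L ^ (q - finrank ℝ E) * nearEnergy μ q R univ W) := by
  have hK : 2 * M / μ (Metric.ball (0 : E) (1 / 2)) ≠ ∞ :=
    ENNReal.div_ne_top (by finiteness) (Metric.measure_ball_pos _ _ (by norm_num)).ne'
  rw [nearEnergy_univ_eq hW]
  refine le_trans ?_ (mul_le_mul_right (lintegral_rpow_neg_mul_ball_average_le μ
    (measurable_totalIncrement hW) q hL R) _)
  rw [← lintegral_const_mul' _ _ hK]
  refine le_trans (lintegral_mono_ae ?_) (setLIntegral_le_lintegral S _)
  filter_upwards [ae_restrict_of_ae (μ.ae_ne 0), ae_restrict_mem hS] with h hh hhS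
  have hρ : 0 < min (L * ‖h‖) R := lt_min (by positivity) hR
  rw [mul_left_comm, mul_comm]
  gcongr
  exact setLIntegral_increment_le hW htri hA hρ (hv h hhS) fun x hx w hw =>
    hAU x hx w (hw.trans_le (min_le_right _ _))

end IncrementEstimates

section MeshRetraction

variable {ι : Type*} {j : ℕ}

/-- The displacement of the retraction onto the `j`-skeleton of the unit mesh. -/
noncomputable def cellShift (j : ℕ) (z : ι → ℝ) : ι → ℝ := cellRetraction j z - z

/-- The retraction onto the `j`-skeleton of the mesh of cubes of side `δ` centered at the points of
`δ (ℤⁿ - τ)`, written as a perturbation of the identity. -/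
noncomputable def meshRetraction (j : ℕ) (δ : ℝ) (τ x : ι → ℝ) : ι → ℝ :=
  x + δ • cellShift j (δ⁻¹ • x + τ)

theorem cellShift_periodic (j : ℕ) (k : ι → ℤ) :
    Function.Periodic (cellShift j) fun i => (k i : ℝ) := fun z => by
  rw [cellShift, cellRetraction_add_intCast, add_sub_add_right_eq_sub, cellShift]

theorem measurable_cellShift [Finite ι] (j : ℕ) : Measurable (cellShift j : (ι → ℝ) → ι → ℝ) :=
  (measurable_cellRetraction j).sub measurable_id

theorem measurable_meshRetraction [Finite ι] (j : ℕ) (δ : ℝ) :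
    Measurable (Function.uncurry (meshRetraction j δ : (ι → ℝ) → (ι → ℝ) → ι → ℝ)) := by
  have hs := measurable_cellShift (ι := ι) j
  simp only [Function.uncurry_def, meshRetraction]
  fun_prop

variable [Fintype ι]

theorem two_mul_norm_smul_cellShift_le {δ : ℝ} (hδ : 0 ≤ δ) (z : ι → ℝ) :
    2 * ‖δ • cellShift j z‖ ≤ δ := by
  rw [norm_smul, Real.norm_of_nonneg hδ]
  have := mul_le_mul_of_nonneg_left (norm_cellRetraction_sub_self_le (j := j) z) hδ
  rw [cellShift]
  linarith

theorem two_mul_norm_meshRetraction_sub_self_le {δ : ℝ} (hδ : 0 ≤ δ) (τ x : ι → ℝ) :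
    2 * ‖meshRetraction j δ τ x - x‖ ≤ δ := by
  rw [meshRetraction, add_sub_cancel_left]
  exact two_mul_norm_smul_cellShift_le hδ _

theorem mapsTo_meshRetraction {δ : ℝ} (hδ : 0 < δ) (τ : ι → ℝ) {A U : Set (ι → ℝ)}
    (hAU : ∀ x ∈ A, Metric.ball x (4 * δ) ⊆ U) : MapsTo (meshRetraction j δ τ) A U :=
  fun x hx => hAU x hx <| by
    rw [mem_ball_iff_norm]
    linarith [two_mul_norm_meshRetraction_sub_self_le (j := j) hδ.le τ x]

theorem two_mul_norm_add_cellShift_sub_le {δ : ℝ} (hδ : 0 < δ) {z h : ι → ℝ}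
    (hz : 0 < cellRadius j z) (hh : ‖h‖ < δ) :
    2 * ‖h + δ • cellShift j (z + δ⁻¹ • h) - δ • cellShift j z‖ ≤
      min (2 / cellRadius j z * ‖h‖) (4 * δ) := by
  refine le_min ?_ ?_
  · have hdiff : h + δ • cellShift j (z + δ⁻¹ • h) - δ • cellShift j z =
        δ • (cellRetraction j (z + δ⁻¹ • h) - cellRetraction j z) := by
      simp only [cellShift, smul_sub, smul_add, smul_inv_smul₀ hδ.ne']
      abel
    have hlip := norm_cellRetraction_sub_le hz (z + δ⁻¹ • h)
    rw [add_sub_cancel_left, norm_smul, norm_inv, Real.norm_of_nonneg hδ.le] at hlip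
    rw [hdiff, norm_smul, Real.norm_of_nonneg hδ.le]
    calc 2 * (δ * _) ≤ 2 * (δ * (δ⁻¹ * ‖h‖ / cellRadius j z)) := by gcongr
      _ = _ := by field_simp
  · linarith [norm_sub_le (h + δ • cellShift j (z + δ⁻¹ • h)) (δ • cellShift j z),
      norm_add_le h (δ • cellShift j (z + δ⁻¹ • h)),
      two_mul_norm_smul_cellShift_le (j := j) hδ.le z,
      two_mul_norm_smul_cellShift_le (j := j) hδ.le (z + δ⁻¹ • h)]

/-- For fixed `x` the substitution `z = a • x + τ` is a translation of the torus `ℝⁿ / ℤⁿ`. -/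
theorem setLIntegral_unitBox_average {g : (ι → ℝ) → (ι → ℝ) → ℝ≥0∞}
    (hg : Measurable (Function.uncurry g))
    (hper : ∀ x, ∀ k : ι → ℤ, Function.Periodic (g x) fun i => (k i : ℝ)) (A : Set (ι → ℝ))
    (a : ℝ) :
    ∫⁻ τ in unitBox ι, ∫⁻ x in A, g x (a • x + τ) = ∫⁻ z in unitBox ι, ∫⁻ x in A, g x z := by
  rw [lintegral_lintegral_swap (f := fun τ x => g x (a • x + τ)),
    lintegral_lintegral_swap (f := fun z x => g x z)]
  · exact lintegral_congr fun x => setLIntegral_unitBox_add (hper x) _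
  · exact (show Measurable fun p : (ι → ℝ) × (ι → ℝ) => g p.2 p.1 by fun_prop).aemeasurable
  · exact (show Measurable fun p : (ι → ℝ) × (ι → ℝ) => g p.2 (a • p.2 + p.1) by
      fun_prop).aemeasurable

variable {W : (ι → ℝ) → (ι → ℝ) → ℝ≥0∞} {M : ℝ≥0∞} {U A : Set (ι → ℝ)} {q δ : ℝ}

theorem setLIntegral_unitBox_displacement_le [Nonempty ι] (hW : Measurable (Function.uncurry W))
    (htri : QuasiTriangle M U W) (hA : MeasurableSet A) (hq : 0 ≤ q) (hδ : 0 < δ)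
    (hAU : ∀ x ∈ A, Metric.ball x δ ⊆ U) :
    ENNReal.ofReal δ ^ ((Fintype.card ι : ℝ) - q) *
        ∫⁻ τ in unitBox ι, ∫⁻ x in A, W x (meshRetraction j δ τ x) ≤
      2 * M / volume (Metric.ball (0 : ι → ℝ) (1 / 2)) * nearEnergy volume q δ univ W := by
  have hs := measurable_cellShift (ι := ι) j
  have havg := setLIntegral_unitBox_average (g := fun x z => W x (x + δ • cellShift j z))
    (by fun_prop) (fun x k z => by simp only [cellShift_periodic j k z]) A δ⁻¹
  have hbound := lintegral_mono (μ := volume.restrict (unitBox ι)) fun z =>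
    setLIntegral_increment_le_nearEnergy (μ := volume) hW htri hA hq hδ
      (two_mul_norm_smul_cellShift_le (j := j) hδ.le z) fun x hx w hw => hAU x hx <| by
        rw [mem_ball_iff_norm, add_sub_cancel_left]
        linarith [norm_nonneg w]
  rw [lintegral_const, measure_univ, mul_one, Module.finrank_fintype_fun_eq_card] at hbound
  simp only [meshRetraction]
  rw [havg]
  refine (mul_le_mul_right hbound _).trans_eq ?_
  rw [mul_left_comm, ← mul_assoc (_ ^ _), ← ENNReal.rpow_add _ _ (by simpa using hδ)
    ENNReal.ofReal_ne_top, sub_add_sub_cancel, sub_self, ENNReal.rpow_zero, one_mul]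

theorem setLIntegral_unitBox_nearEnergy_eq (hW : Measurable (Function.uncurry W)) (q δ : ℝ)
    (A : Set (ι → ℝ)) :
    ∫⁻ τ in unitBox ι, nearEnergy volume q δ A
        (fun x y => W (meshRetraction j δ τ x) (meshRetraction j δ τ y)) =
      ∫⁻ z in unitBox ι, ∫⁻ h in Metric.ball 0 δ, (∫⁻ x in A, W (x + δ • cellShift j z)
        (x + (h + δ • cellShift j (z + δ⁻¹ • h)))) * ‖h‖ₑ ^ (-q) := by
  have hs := measurable_cellShift (ι := ι) j
  set H : (ι → ℝ) → (ι → ℝ) → (ι → ℝ) → ℝ≥0∞ := fun x z h =>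
    W (x + δ • cellShift j z) (x + (h + δ • cellShift j (z + δ⁻¹ • h))) * ‖h‖ₑ ^ (-q) with hH
  have hHm : Measurable fun p : ((ι → ℝ) × (ι → ℝ)) × (ι → ℝ) => H p.1.1 p.1.2 p.2 := by
    simp only [hH]
    fun_prop
  have hper (x : ι → ℝ) (k : ι → ℤ) :
      Function.Periodic (fun z => ∫⁻ h in Metric.ball 0 δ, H x z h) fun i => (k i : ℝ) :=
    fun z => by
      simp only [hH, add_right_comm z fun i => (k i : ℝ), cellShift_periodic j k _]
  have hmesh (τ : ι → ℝ) : nearEnergy volume q δ A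
      (fun x y => W (meshRetraction j δ τ x) (meshRetraction j δ τ y)) =
        ∫⁻ x in A, ∫⁻ h in Metric.ball 0 δ, H x (δ⁻¹ • x + τ) h := by
    simp only [nearEnergy, hH, meshRetraction, smul_add, add_assoc, add_comm τ]
  simp only [hmesh]
  rw [setLIntegral_unitBox_average hHm.lintegral_prod_right' hper]
  refine lintegral_congr fun z => ?_
  rw [lintegral_lintegral_swap (f := fun x h => H x z h)
    (hHm.comp (f := fun p : (ι → ℝ) × (ι → ℝ) => ((p.1, z), p.2)) (by fun_prop)).aemeasurable]
  exact lintegral_congr fun h => lintegral_mul_const _ (by fun_prop)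

theorem measurable_nearEnergy_comp_meshRetraction (hW : Measurable (Function.uncurry W)) (q δ : ℝ)
    (A : Set (ι → ℝ)) :
    Measurable fun τ => nearEnergy volume q δ A
      fun x y => W (meshRetraction j δ τ x) (meshRetraction j δ τ y) := by
  have hP := measurable_meshRetraction (ι := ι) j δ
  have hinner : Measurable fun p : ((ι → ℝ) × (ι → ℝ)) × (ι → ℝ) =>
      W (meshRetraction j δ p.1.1 p.1.2) (meshRetraction j δ p.1.1 (p.1.2 + p.2)) *
        ‖p.2‖ₑ ^ (-q) := by
    fun_prop
  exact hinner.lintegral_prod_right'.lintegral_prod_right'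

theorem setLIntegral_unitBox_nearEnergy_le [Nonempty ι] (hj : j < Fintype.card ι)
    (hW : Measurable (Function.uncurry W)) (htri : QuasiTriangle M U W) (hM : M ≠ ∞)
    (hA : MeasurableSet A) (q : ℝ) (hδ : 0 < δ) (hAU : ∀ x ∈ A, Metric.ball x (4 * δ) ⊆ U) :
    ∫⁻ τ in unitBox ι, nearEnergy volume q δ A
        (fun x y => W (meshRetraction j δ τ x) (meshRetraction j δ τ y)) ≤
      (∫⁻ z in unitBox ι, ENNReal.ofReal (cellRadius j z) ^ (-(q - Fintype.card ι))) *
        (2 * M / volume (Metric.ball (0 : ι → ℝ) (1 / 2)) *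
          (kernelTail (volume : Measure (ι → ℝ)) q 1 * 2 ^ (q - Fintype.card ι)) *
          nearEnergy volume q (4 * δ) univ W) := by
  have hr := measurable_cellRadius (ι := ι) j
  rw [setLIntegral_unitBox_nearEnergy_eq hW, ← lintegral_mul_const _ (by fun_prop)]
  refine lintegral_mono_ae ?_
  filter_upwards [ae_cellRadius_pos hj] with z hz
  have hshift {x w : ι → ℝ} (hx : x ∈ A) (hw : 2 * ‖w‖ < 4 * δ) :
      x + δ • cellShift j z + w ∈ U := by
    refine hAU x hx ?_
    rw [mem_ball_iff_norm, add_assoc, add_sub_cancel_left]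
    linarith [norm_add_le (δ • cellShift j z) w, two_mul_norm_smul_cellShift_le (j := j) hδ.le z]
  refine (setLIntegral_dilated_increment_le hW htri hM hA q (L := 2 / cellRadius j z) (R := 4 * δ)
    (by positivity) (by positivity) measurableSet_ball (fun h hh =>
      two_mul_norm_add_cellShift_sub_le hδ hz (mem_ball_zero_iff.1 hh))
    fun x hx w hw => hshift hx hw).trans_eq ?_
  rw [Module.finrank_fintype_fun_eq_card, div_eq_mul_inv 2, ENNReal.ofReal_mul two_pos.le,
    ENNReal.ofReal_inv_of_pos hz, ENNReal.ofReal_ofNat,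
    ENNReal.mul_rpow_of_ne_top (by simp) (by simpa using hz), ENNReal.inv_rpow, ENNReal.rpow_neg]
  ring

/-- The mesh is translated by a `τ` for which the sum of the displacement and of the near energy of
the retraction is at most its mean. -/
theorem exists_meshRetraction_energy_le (hj : j < Fintype.card ι)
    (hW : Measurable (Function.uncurry W)) (hM : M ≠ ∞) (htri : QuasiTriangle M U W)
    (hq : (Fintype.card ι : ℝ) < q) (hqj : q - Fintype.card ι < (j : ℝ) + 1) :
    ∃ B : ℝ≥0∞, B ≠ ∞ ∧ ∀ δ : ℝ, 0 < δ → ∀ A : Set (ι → ℝ), MeasurableSet A →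
      (∀ x ∈ A, Metric.ball x (4 * δ) ⊆ U) → ∃ τ : ι → ℝ,
        ENNReal.ofReal δ ^ ((Fintype.card ι : ℝ) - q) *
            (∫⁻ x in A, W x (meshRetraction j δ τ x)) +
          nearEnergy volume q δ A
            (fun x y => W (meshRetraction j δ τ x) (meshRetraction j δ τ y)) ≤
          B * nearEnergy volume q (4 * δ) univ W := by
  have : Nonempty ι := Fintype.card_pos_iff.1 ((Nat.zero_le j).trans_lt hj)
  have hq0 : 0 ≤ q := (Nat.cast_nonneg _).trans hq.le
  set N := (Fintype.card ι : ℝ)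
  set K := 2 * M / volume (Metric.ball (0 : ι → ℝ) (1 / 2))
  set T := kernelTail (volume : Measure (ι → ℝ)) q 1 * 2 ^ (q - N)
  set I := ∫⁻ z in unitBox ι, ENNReal.ofReal (cellRadius j z) ^ (-(q - N))
  have hK : K ≠ ∞ :=
    ENNReal.div_ne_top (by finiteness) (Metric.measure_ball_pos _ _ (by norm_num)).ne'
  have hT : T ≠ ∞ := ENNReal.mul_ne_top (kernelTail_one_lt_top _ (by simpa using hq)).ne (by simp)
  have hI : I ≠ ∞ := (setLIntegral_cellRadius_rpow_neg_lt_top hj (sub_nonneg.2 hq.le) hqj).ne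
  refine ⟨K + I * (K * T), by finiteness, fun δ hδ A hA hAU => ?_⟩
  have hP := measurable_meshRetraction (ι := ι) j δ
  have hdisp : Measurable fun τ => ∫⁻ x in A, W x (meshRetraction j δ τ x) :=
    (show Measurable fun p : (ι → ℝ) × (ι → ℝ) => W p.2 (meshRetraction j δ p.1 p.2) by
      fun_prop).lintegral_prod_right'
  obtain ⟨τ, hτ⟩ := exists_le_lintegral (μ := volume.restrict (unitBox ι))
    ((hdisp.const_mul (ENNReal.ofReal δ ^ (N - q))).add
      (measurable_nearEnergy_comp_meshRetraction (j := j) hW q δ A)).aemeasurable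
  refine ⟨τ, hτ.trans ?_⟩
  simp only [Pi.add_apply]
  rw [lintegral_add_left (hdisp.const_mul _), lintegral_const_mul _ hdisp, add_mul]
  refine add_le_add ?_
    ((setLIntegral_unitBox_nearEnergy_le hj hW htri hM hA q hδ hAU).trans_eq (by ring))
  refine (setLIntegral_unitBox_displacement_le hW htri hA hq0 hδ fun x hx =>
    (Metric.ball_subset_ball (by linarith)).trans (hAU x hx)).trans ?_
  gcongr
  exact nearEnergy_mono_radius q (by linarith) univ

end MeshRetraction

section FarNear

variable {E : Type*} [NormedAddCommGroup E] [MeasurableSpace E] [BorelSpace E] {μ : Measure E}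
  [μ.IsAddLeftInvariant]

theorem setLIntegral_mul_indicator_ball_le (A : Set E) (W : E → E → ℝ≥0∞) (q δ : ℝ) :
    ∫⁻ x in A, ∫⁻ y in A,
        W x y * (Metric.ball 0 δ).indicator (fun h => ‖h‖ₑ ^ (-q)) (y - x) ∂μ ∂μ ≤
      nearEnergy μ q δ A W := by
  refine lintegral_mono fun x => (setLIntegral_le_lintegral _ _).trans_eq ?_
  rw [← lintegral_indicator measurableSet_ball, ← lintegral_add_left_eq_self _ x]
  refine lintegral_congr fun h => ?_
  rw [add_sub_cancel_left]
  exact (indicator_mul_right _ (fun h => W x (x + h)) _).symm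

variable [SecondCountableTopology E] [SFinite μ] {W : E → E → ℝ≥0∞}

theorem lintegral_totalIncrement_mul (hW : Measurable (Function.uncurry W)) (q : ℝ) :
    ∫⁻ k, totalIncrement μ W k * ‖k‖ₑ ^ (-q) ∂μ = ∫⁻ x, ∫⁻ y, W x y * ‖y - x‖ₑ ^ (-q) ∂μ ∂μ := by
  have hjoint : Measurable fun a : E × E => W a.2 (a.2 + a.1) * ‖a.1‖ₑ ^ (-q) := by fun_prop
  calc _ = ∫⁻ k, ∫⁻ x, W x (x + k) * ‖k‖ₑ ^ (-q) ∂μ ∂μ :=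
        lintegral_congr fun k => (lintegral_mul_const _ (by fun_prop)).symm
    _ = ∫⁻ x, ∫⁻ k, W x (x + k) * ‖k‖ₑ ^ (-q) ∂μ ∂μ := lintegral_lintegral_swap hjoint.aemeasurable
    _ = _ := lintegral_congr fun x => by
        rw [← lintegral_sub_right_eq_self _ x]
        simp only [add_sub_cancel]

theorem tendsto_nearEnergy_univ [IsLocallyFiniteMeasure μ] [NullSingletonClass μ]
    (hW : Measurable (Function.uncurry W)) {q : ℝ}
    (hfin : ∫⁻ x, ∫⁻ y, W x y * ‖y - x‖ₑ ^ (-q) ∂μ ∂μ ≠ ∞) :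
    Tendsto (fun δ => nearEnergy μ q δ univ W) (𝓝[>] 0) (𝓝 0) := by
  simp only [nearEnergy_univ_eq hW]
  rw [← lintegral_totalIncrement_mul hW] at hfin
  obtain ⟨S, hS, hSfin⟩ := μ.finiteAt_nhds (0 : E)
  obtain ⟨R, hR, hRS⟩ := Metric.mem_nhds_iff.1 hS
  have hball : Tendsto (fun δ => μ (Metric.thickening δ {(0 : E)})) (𝓝[>] 0) (𝓝 (μ {0})) :=
    tendsto_measure_thickening_of_isClosed
      ⟨R, hR, by simpa using (measure_mono hRS).trans_lt hSfin |>.ne⟩ isClosed_singleton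
  simp only [Metric.thickening_singleton, measure_singleton] at hball
  exact tendsto_setLIntegral_zero hfin hball

theorem setLIntegral_add_mul_comp_sub_le [μ.IsNegInvariant] (A : Set E) {u g : E → ℝ≥0∞}
    (hu : Measurable u) (hg : Measurable g) :
    ∫⁻ x in A, ∫⁻ y in A, (u x + u y) * g (y - x) ∂μ ∂μ ≤
      2 * (∫⁻ h, g h ∂μ) * ∫⁻ x in A, u x ∂μ := by
  have hswap : ∫⁻ x in A, ∫⁻ y in A, u y * g (y - x) ∂μ ∂μ =
      ∫⁻ y in A, ∫⁻ x in A, u y * g (y - x) ∂μ ∂μ :=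
    lintegral_lintegral_swap (Measurable.aemeasurable (by fun_prop))
  calc _ = (∫⁻ x in A, ∫⁻ y in A, u x * g (y - x) ∂μ ∂μ) +
          ∫⁻ y in A, ∫⁻ x in A, u y * g (y - x) ∂μ ∂μ := by
        rw [← hswap, ← lintegral_add_left (Measurable.lintegral_prod_right (by fun_prop))]
        refine lintegral_congr fun x => ?_
        rw [← lintegral_add_left (by fun_prop)]
        simp only [add_mul]
    _ = (∫⁻ x in A, u x * ∫⁻ y in A, g (y - x) ∂μ ∂μ) +
          ∫⁻ y in A, u y * ∫⁻ x in A, g (y - x) ∂μ ∂μ := by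
        congr 1 <;>
          exact lintegral_congr fun x => lintegral_const_mul _ (by fun_prop)
    _ ≤ (∫⁻ x in A, u x * ∫⁻ h, g h ∂μ ∂μ) + ∫⁻ y in A, u y * ∫⁻ h, g h ∂μ ∂μ := by
        refine add_le_add (lintegral_mono fun x => ?_) (lintegral_mono fun y => ?_)
        · rw [← lintegral_sub_right_eq_self g x]
          exact mul_le_mul_right (setLIntegral_le_lintegral _ _) _
        · rw [← lintegral_sub_left_eq_self g y]
          exact mul_le_mul_right (setLIntegral_le_lintegral _ _) _
    _ = _ := by
        rw [lintegral_mul_const _ hu]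
        ring

theorem setLIntegral_le_kernelTail_add_nearEnergy [μ.IsNegInvariant] {A : Set E}
    (hA : MeasurableSet A) {V : E → E → ℝ≥0∞} {u : E → ℝ≥0∞} (hu : Measurable u) {δ : ℝ}
    (hfar : ∀ x ∈ A, ∀ y ∈ A, δ ≤ ‖y - x‖ → V x y ≤ u x + u y)
    (hnear : ∀ x ∈ A, ∀ y ∈ A, ‖y - x‖ < δ → V x y ≤ W x y) (q : ℝ) :
    ∫⁻ x in A, ∫⁻ y in A, V x y * ‖y - x‖ₑ ^ (-q) ∂μ ∂μ ≤
      2 * kernelTail μ q δ * (∫⁻ x in A, u x ∂μ) + nearEnergy μ q δ A W := by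
  set far : E → ℝ≥0∞ := {h | δ ≤ ‖h‖}.indicator fun h => ‖h‖ₑ ^ (-q)
  set near : E → ℝ≥0∞ := (Metric.ball 0 δ).indicator fun h => ‖h‖ₑ ^ (-q)
  have hset : MeasurableSet {h : E | δ ≤ ‖h‖} := measurableSet_le (by fun_prop) (by fun_prop)
  have hfarm : Measurable far := Measurable.indicator (by fun_prop) hset
  have hpt : ∀ x ∈ A, ∀ y ∈ A, V x y * ‖y - x‖ₑ ^ (-q) ≤
      (u x + u y) * far (y - x) + W x y * near (y - x) := fun x hx y hy => by
    rcases le_or_gt δ ‖y - x‖ with h | h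
    · simp only [far, indicator_of_mem (s := {h : E | δ ≤ ‖h‖}) h]
      exact le_add_right (by gcongr; exact hfar x hx y hy h)
    · simp only [near, indicator_of_mem (mem_ball_zero_iff.2 h)]
      exact le_add_left (by gcongr; exact hnear x hx y hy h)
  calc _ ≤ ∫⁻ x in A, ∫⁻ y in A, (u x + u y) * far (y - x) + W x y * near (y - x) ∂μ ∂μ :=
        setLIntegral_mono' hA fun x hx => setLIntegral_mono' hA fun y hy => hpt x hx y hy
    _ = (∫⁻ x in A, ∫⁻ y in A, (u x + u y) * far (y - x) ∂μ ∂μ) +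
          ∫⁻ x in A, ∫⁻ y in A, W x y * near (y - x) ∂μ ∂μ := by
        rw [← lintegral_add_left (Measurable.lintegral_prod_right (by fun_prop))]
        exact lintegral_congr fun x => lintegral_add_left (by fun_prop) _
    _ ≤ _ := by
        refine add_le_add ?_ (setLIntegral_mul_indicator_ball_le A W q δ)
        rw [kernelTail, ← lintegral_indicator hset]
        exact setLIntegral_add_mul_comp_sub_le A hu hfarm

end FarNear

section LocalizedIncrement

theorem enorm_add_rpow_le {V : Type*} [NormedAddCommGroup V] {p : ℝ} (hp : 1 ≤ p) (u v : V) :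
    ‖u + v‖ₑ ^ p ≤ 2 ^ (p - 1) * (‖u‖ₑ ^ p + ‖v‖ₑ ^ p) :=
  (ENNReal.rpow_le_rpow (enorm_add_le u v) (by linarith)).trans
    (ENNReal.rpow_add_le_mul_rpow_add_rpow _ _ hp)

theorem enorm_sub_rpow_le {V : Type*} [NormedAddCommGroup V] {p : ℝ} (hp : 1 ≤ p) (u v : V) :
    ‖u - v‖ₑ ^ p ≤ 2 ^ (p - 1) * (‖u‖ₑ ^ p + ‖v‖ₑ ^ p) := by
  simpa only [sub_eq_add_neg, enorm_neg] using enorm_add_rpow_le hp u (-v)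

variable {E V : Type*} [NormedAddCommGroup V] {p : ℝ} {U : Set E} {f : E → V}

/-- The two-point function `‖f x - f y‖ ^ p`, cut off to the pairs of points of `U`. -/
noncomputable def localizedIncrement (p : ℝ) (U : Set E) (f : E → V) (x y : E) : ℝ≥0∞ :=
  (U ×ˢ U).indicator (fun a => ‖f a.1 - f a.2‖ₑ ^ p) (x, y)

theorem localizedIncrement_of_mem {x y : E} (hx : x ∈ U) (hy : y ∈ U) :
    localizedIncrement p U f x y = ‖f x - f y‖ₑ ^ p :=
  indicator_of_mem (mk_mem_prod hx hy) _

theorem localizedIncrement_of_notMem {x y : E} (h : (x, y) ∉ U ×ˢ U) :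
    localizedIncrement p U f x y = 0 :=
  indicator_of_notMem h _

theorem measurable_localizedIncrement [MeasurableSpace E] [MeasurableSpace V] [BorelSpace V]
    [SecondCountableTopology V] (hU : MeasurableSet U) (hf : Measurable f) :
    Measurable (Function.uncurry (localizedIncrement p U f)) :=
  Measurable.indicator (by fun_prop) (hU.prod hU)

theorem quasiTriangle_localizedIncrement (hp : 1 ≤ p) :
    QuasiTriangle (2 ^ (p - 1)) U (localizedIncrement p U f) := by
  intro x y v hv
  by_cases h : (x, y) ∈ U ×ˢ U
  · rw [localizedIncrement_of_mem h.1 h.2, localizedIncrement_of_mem h.1 hv,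
      localizedIncrement_of_mem hv h.2, ← sub_add_sub_cancel (f x) (f v) (f y)]
    exact enorm_add_rpow_le hp _ _
  · rw [localizedIncrement_of_notMem h]
    exact zero_le

variable [NormedAddCommGroup E] [MeasurableSpace E]

theorem lintegral_localizedIncrement_mul (μ : Measure E) (hU : MeasurableSet U) (q : ℝ) :
    ∫⁻ x, ∫⁻ y, localizedIncrement p U f x y * ‖y - x‖ₑ ^ (-q) ∂μ ∂μ =
      ∫⁻ x in U, ∫⁻ y in U, ‖f x - f y‖ₑ ^ p * ‖y - x‖ₑ ^ (-q) ∂μ ∂μ := by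
  classical
  simp only [← lintegral_indicator hU]
  refine lintegral_congr fun x => ?_
  by_cases hx : x ∈ U
  · simp only [indicator_of_mem hx]
    refine lintegral_congr fun y => ?_
    by_cases hy : y ∈ U
    · rw [indicator_of_mem hy, localizedIncrement_of_mem hx hy]
    · rw [indicator_of_notMem hy, localizedIncrement_of_notMem (mt And.right hy), zero_mul]
  · simp [indicator_of_notMem hx, localizedIncrement_of_notMem (mt And.left hx)]

theorem setLIntegral_comp_sub_self_le [BorelSpace E] [SecondCountableTopology E]
    [MeasurableSpace V] [BorelSpace V] [SecondCountableTopology V] {μ : Measure E} [SFinite μ]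
    [μ.IsAddLeftInvariant] [μ.IsNegInvariant] (hp : 1 ≤ p) (hU : MeasurableSet U)
    (hf : Measurable f) {A : Set E} (hA : MeasurableSet A) (hAU : A ⊆ U) {P : E → E}
    (hP : Measurable P) (hPU : MapsTo P A U) (q δ : ℝ) :
    ∫⁻ x in A, ∫⁻ y in A, ‖(f (P x) - f x) - (f (P y) - f y)‖ₑ ^ p * ‖y - x‖ₑ ^ (-q) ∂μ ∂μ ≤
      2 ^ (p - 1) * (2 * kernelTail μ q δ * (∫⁻ x in A, localizedIncrement p U f x (P x) ∂μ) +
        (nearEnergy μ q δ A (localizedIncrement p U f) +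
          nearEnergy μ q δ A fun x y => localizedIncrement p U f (P x) (P y))) := by
  set W := localizedIncrement p U f
  have hW : Measurable (Function.uncurry W) := measurable_localizedIncrement hU hf
  have hWmem : ∀ x ∈ U, ∀ y ∈ U, W x y = ‖f x - f y‖ₑ ^ p := fun _ hx _ hy =>
    localizedIncrement_of_mem hx hy
  have hM : (2 : ℝ≥0∞) ^ (p - 1) ≠ ∞ :=
    ENNReal.rpow_ne_top_of_nonneg (by linarith) ENNReal.ofNat_ne_top
  have hfar : ∀ x ∈ A, ∀ y ∈ A, δ ≤ ‖y - x‖ → ‖(f (P x) - f x) - (f (P y) - f y)‖ₑ ^ p ≤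
      2 ^ (p - 1) * W x (P x) + 2 ^ (p - 1) * W y (P y) := fun x hx y hy _ => by
    rw [hWmem _ (hAU hx) _ (hPU hx), hWmem _ (hAU hy) _ (hPU hy), ← mul_add, enorm_sub_rev (f x),
      enorm_sub_rev (f y)]
    exact enorm_sub_rpow_le hp _ _
  have hnear : ∀ x ∈ A, ∀ y ∈ A, ‖y - x‖ < δ → ‖(f (P x) - f x) - (f (P y) - f y)‖ₑ ^ p ≤
      2 ^ (p - 1) * (W x y + W (P x) (P y)) := fun x hx y hy _ => by
    rw [hWmem _ (hAU hx) _ (hAU hy), hWmem _ (hPU hx) _ (hPU hy), sub_sub_sub_comm,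
      add_comm (‖f x - f y‖ₑ ^ p)]
    exact enorm_sub_rpow_le hp _ _
  refine (setLIntegral_le_kernelTail_add_nearEnergy hA (by fun_prop) hfar hnear q).trans_eq ?_
  rw [lintegral_const_mul' _ _ hM, nearEnergy_const_mul hM, nearEnergy_add hW]
  ring

end LocalizedIncrement

section CubicMesh

variable {n j : ℕ}

theorem meshRetraction_eq (j : ℕ) {δ : ℝ} (hδ : δ ≠ 0) (τ x : Fin n → ℝ) :
    meshRetraction j δ τ x = δ • (cellRetraction j (δ⁻¹ • x + τ) - τ) := by
  simp only [meshRetraction, cellShift, smul_sub, smul_add, smul_inv_smul₀ hδ]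
  abel

namespace CubicMesh

variable {C : CubicMesh n} {δ : ℝ} {τ x : Fin n → ℝ} {K : Fin n → ℤ} {σ : Fin n → SignType}

theorem faceCenter_add_radial_mem_face (hx : x ∈ C.face K σ) (hxc : x ≠ C.faceCenter K σ) :
    C.faceCenter K σ + (C.ε / ‖x - C.faceCenter K σ‖) • (x - C.faceCenter K σ) ∈ C.face K σ := by
  set c := C.faceCenter K σ
  have hnorm : 0 < ‖x - c‖ := norm_pos_iff.2 (sub_ne_zero.2 hxc)
  intro i
  refine ⟨?_, fun hi => ?_⟩ <;> simp only [Pi.add_apply, Pi.smul_apply, Pi.sub_apply, smul_eq_mul]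
  · rw [add_sub_cancel_left, abs_mul, abs_of_nonneg (div_nonneg C.ε_pos.le hnorm.le),
      div_mul_eq_mul_div, div_le_iff₀ hnorm]
    exact mul_le_mul_of_nonneg_left (norm_le_pi_norm (x - c) i) C.ε_pos.le
  · rw [(hx i).2 hi, sub_self, mul_zero, add_zero]

theorem inv_smul_add_sub_intCast (hT : C.T = -(δ • τ)) (hε : 2 * C.ε = δ) (K : Fin n → ℤ)
    (σ : Fin n → SignType) (x : Fin n → ℝ) (i : Fin n) :
    (δ⁻¹ • x + τ) i - K i = δ⁻¹ * (x i - C.faceCenter K σ i) + ((σ i : SignType) : ℝ) / 2 := by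
  have hε0 := C.ε_pos.ne'
  subst hε
  simp only [Pi.add_apply, Pi.smul_apply, smul_eq_mul, faceCenter, hT, Pi.neg_apply]
  field_simp
  ring

theorem abs_inv_smul_add_sub_intCast_le (hT : C.T = -(δ • τ)) (hε : 2 * C.ε = δ)
    (hx : x ∈ C.face K σ) (i : Fin n) :
    |(δ⁻¹ • x + τ) i - K i| ≤ 1 / 2 ∧ (σ i ≠ 0 → |(δ⁻¹ • x + τ) i - K i| = 1 / 2) := by
  have hhalf : δ⁻¹ * C.ε = 1 / 2 := by
    have := C.ε_pos.ne'
    rw [← hε]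
    field_simp
  have hδ : 0 < δ := by linarith [C.ε_pos]
  rw [inv_smul_add_sub_intCast hT hε K σ]
  rcases hσ : σ i with _ | _ | _
  · simp only [SignType.zero_eq_zero, ne_eq, not_true_eq_false, false_imp_iff, and_true,
      SignType.coe_zero, zero_div, add_zero]
    rw [abs_mul, abs_of_pos (inv_pos.2 hδ), ← hhalf]
    gcongr
    exact (hx i).1
  all_goals
    rw [(hx i).2 (by simp [hσ])]
    norm_num

/-- `f` composed with the retraction is its own homogeneous extension from each skeleton to the
next, because the retraction does not change along the rays from the center of a face of dimension
greater than `j`. -/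
theorem isPiecewiseHomogeneous_comp_meshRetraction {α : Type*} (hT : C.T = -(δ • τ))
    (hε : 2 * C.ε = δ) (f : (Fin n → ℝ) → α) :
    C.IsPiecewiseHomogeneous j fun x => f (meshRetraction j δ τ x) := by
  refine ⟨fun _ x => f (meshRetraction j δ τ x), fun _ _ => rfl, ?_, fun _ _ => rfl⟩
  intro l hjl _ K _ σ hσ x hx hxc
  have hδ : 0 < δ := by linarith [C.ε_pos]
  have ht : 0 < C.ε / ‖x - C.faceCenter K σ‖ :=
    div_pos C.ε_pos (norm_pos_iff.2 (sub_ne_zero.2 hxc))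
  have hx' := faceCenter_add_radial_mem_face hx hxc
  dsimp only
  rw [meshRetraction_eq j hδ.ne', meshRetraction_eq j hδ.ne', eq_comm]
  congr 3
  refine cellRetraction_scale (k := K) (I := Finset.univ.filter fun i => σ i = 0)
    (by rw [faceDim] at hσ; omega) ht (fun i => (abs_inv_smul_add_sub_intCast_le hT hε hx i).1)
    (fun i => (abs_inv_smul_add_sub_intCast_le hT hε hx' i).1)
    (fun i hi => (abs_inv_smul_add_sub_intCast_le hT hε hx i).2 (by simpa using hi))
    (fun i hi => ?_) fun i hi => ?_
  · have hi : σ i ≠ 0 := by simpa using hi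
    simp only [Pi.add_apply, Pi.smul_apply, smul_eq_mul, (hx i).2 hi, Pi.sub_apply, sub_self,
      mul_zero, add_zero]
  · have hi : σ i = 0 := by simpa using hi
    rw [inv_smul_add_sub_intCast hT hε K σ, inv_smul_add_sub_intCast hT hε K σ]
    simp only [hi, SignType.coe_zero, zero_div, add_zero, Pi.add_apply, Pi.smul_apply, smul_eq_mul,
      Pi.sub_apply, add_sub_cancel_left]
    ring

theorem exists_cover (T : Fin n → ℝ) {ε : ℝ} (hε : 0 < ε) {S : Set (Fin n → ℝ)}
    (hS : Bornology.IsBounded S) :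
    ∃ C : CubicMesh n, C.T = T ∧ C.ε = ε ∧ S ⊆ C.carrier ∧
      ∀ x ∈ C.carrier, ∃ y ∈ S, ‖x - y‖ ≤ 2 * ε := by
  set cubeIndex : (Fin n → ℝ) → Fin n → ℤ := fun x i => round ((x i - T i) / (2 * ε))
  have hdist (x : Fin n → ℝ) (i : Fin n) : |x i - (T i + 2 * ε * cubeIndex x i)| ≤ ε := by
    calc |x i - (T i + 2 * ε * cubeIndex x i)|
        = 2 * ε * |(x i - T i) / (2 * ε) - cubeIndex x i| := by
          conv_rhs => rw [← abs_of_pos (by positivity : 0 < 2 * ε), ← abs_mul, abs_of_pos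
            (by positivity : 0 < 2 * ε), mul_sub, mul_div_cancel₀ _ (by positivity), sub_sub]
      _ ≤ 2 * ε * (1 / 2) := by gcongr; exact abs_sub_round _
      _ = ε := by ring
  have hfin : (cubeIndex '' S).Finite := by
    obtain ⟨a, ha⟩ := hS.bddBelow
    obtain ⟨b, hb⟩ := hS.bddAbove
    have hmono : Monotone cubeIndex := fun x y hxy i => by
      simp only [cubeIndex, round_eq]
      gcongr
      exact hxy i
    refine (Set.finite_Icc (cubeIndex a) (cubeIndex b)).subset ?_
    rintro _ ⟨x, hx, rfl⟩
    exact ⟨hmono (ha hx), hmono (hb hx)⟩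
  refine ⟨⟨T, ε, hε, hfin.toFinset⟩, rfl, rfl,
    fun x hx => ⟨cubeIndex x, hfin.mem_toFinset.2 ⟨x, hx, rfl⟩, hdist x⟩, ?_⟩
  rintro x ⟨K, hK, hxK⟩
  obtain ⟨y, hy, rfl⟩ := hfin.mem_toFinset.1 hK
  refine ⟨y, hy, (pi_norm_le_iff_of_nonneg (by positivity)).2 fun i => ?_⟩
  calc ‖(x - y) i‖ ≤ |x i - (T i + 2 * ε * cubeIndex y i)| +
        |T i + 2 * ε * cubeIndex y i - y i| := abs_sub_le _ _ _
    _ ≤ ε + ε := add_le_add (hxK i) (abs_sub_comm (y i) _ ▸ hdist y i)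
    _ = 2 * ε := by ring

end CubicMesh

end CubicMesh

section Sobolev

variable {n m : ℕ} {s p : ℝ} {A A' ω : Set (Fin n → ℝ)} {F : Set (EuclideanSpace ℝ (Fin m))}
  {f g : (Fin n → ℝ) → EuclideanSpace ℝ (Fin m)}

theorem gagliardoEnergy_eq_mul (s p : ℝ) (A : Set (Fin n → ℝ))
    (f : (Fin n → ℝ) → EuclideanSpace ℝ (Fin m)) :
    gagliardoEnergy s p A f =
      ∫⁻ x in A, ∫⁻ y in A, ‖f x - f y‖ₑ ^ p * ‖y - x‖ₑ ^ (-((n : ℝ) + s * p)) :=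
  lintegral_congr fun x => lintegral_congr fun y => by
    rw [div_eq_mul_inv, ← ENNReal.rpow_neg, enorm_sub_rev x y]

theorem gagliardoEnergy_mono (h : A ⊆ A') : gagliardoEnergy s p A f ≤ gagliardoEnergy s p A' f :=
  (lintegral_mono_set h).trans (lintegral_mono fun _ => lintegral_mono_set h)

theorem gagliardoEnergy_lt_top_of_sobolevNorm_lt_top (hp : 0 < p) (h : sobolevNorm s p A f < ∞) :
    gagliardoEnergy s p A f < ∞ :=
  (ENNReal.rpow_lt_top_iff_of_pos (one_div_pos.2 hp)).1 (le_add_self.trans_lt h)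

theorem gagliardoEnergy_add_le (hp : 1 ≤ p) (hf : Measurable f) :
    gagliardoEnergy s p A (fun x => f x + g x) ≤
      2 ^ (p - 1) * (gagliardoEnergy s p A f + gagliardoEnergy s p A g) := by
  have hM : (2 : ℝ≥0∞) ^ (p - 1) ≠ ∞ :=
    ENNReal.rpow_ne_top_of_nonneg (by linarith) ENNReal.ofNat_ne_top
  simp only [gagliardoEnergy_eq_mul]
  rw [← lintegral_add_left (Measurable.lintegral_prod_right (by fun_prop)),
    ← lintegral_const_mul' _ _ hM]
  refine lintegral_mono fun x => ?_
  rw [← lintegral_add_left (by fun_prop), ← lintegral_const_mul' _ _ hM]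
  refine lintegral_mono fun y => ?_
  rw [← add_mul, ← mul_assoc, add_sub_add_comm]
  gcongr
  exact enorm_add_rpow_le hp _ _

theorem sobolevNorm_mono (hp : 0 ≤ p) (h : A ⊆ A') : sobolevNorm s p A f ≤ sobolevNorm s p A' f :=
  add_le_add (eLpNorm_mono_measure f (Measure.restrict_mono_set _ h))
    (ENNReal.rpow_le_rpow (gagliardoEnergy_mono h) (one_div_nonneg.2 hp))

theorem sobolevNorm_congr (h : f =ᵐ[volume.restrict A] g) :
    sobolevNorm s p A f = sobolevNorm s p A g := by
  have henergy : gagliardoEnergy s p A f = gagliardoEnergy s p A g := by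
    refine lintegral_congr_ae ?_
    filter_upwards [h] with x hx
    refine lintegral_congr_ae ?_
    filter_upwards [h] with y hy
    rw [hx, hy]
  rw [sobolevNorm, sobolevNorm, eLpNorm_congr_ae h, henergy]

theorem sobolevNorm_add_lt_top (hp : 1 ≤ p) (hf : Measurable f)
    (hg : AEStronglyMeasurable g (volume.restrict A)) (hf' : sobolevNorm s p A f < ∞)
    (hg' : sobolevNorm s p A g < ∞) : sobolevNorm s p A (fun x => f x + g x) < ∞ := by
  have hp' : 0 < p := by linarith
  have hM : (2 : ℝ≥0∞) ^ (p - 1) < ∞ :=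
    ENNReal.rpow_lt_top_of_nonneg (by linarith) ENNReal.ofNat_ne_top
  refine ENNReal.add_lt_top.2 ⟨eLpNorm_add_lt_top
    ⟨hf.aestronglyMeasurable, le_self_add.trans_lt hf'⟩ ⟨hg, le_self_add.trans_lt hg'⟩,
    (ENNReal.rpow_lt_top_iff_of_pos (one_div_pos.2 hp')).2 ?_⟩
  exact (gagliardoEnergy_add_le hp hf).trans_lt (ENNReal.mul_lt_top hM (ENNReal.add_lt_top.2
    ⟨gagliardoEnergy_lt_top_of_sobolevNorm_lt_top hp' hf',
      gagliardoEnergy_lt_top_of_sobolevNorm_lt_top hp' hg'⟩))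

theorem MemSobolev.mono (hp : 0 ≤ p) (h : A ⊆ A') (hf : MemSobolev s p A' F f) :
    MemSobolev s p A F f :=
  ⟨hf.1.mono_set h, (sobolevNorm_mono hp h).trans_lt hf.2.1,
    ae_restrict_of_ae_restrict_of_subset h hf.2.2⟩

theorem MemSobolev.exists_measurable_mapsTo (hf : MemSobolev s p ω F f) (hω : IsOpen ω) :
    ∃ g : (Fin n → ℝ) → EuclideanSpace ℝ (Fin m), Measurable g ∧ MapsTo g ω F ∧
      f =ᵐ[volume.restrict ω] g := by
  rcases F.eq_empty_or_nonempty with rfl | hF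
  · have hω0 : ω = ∅ := by
      have hbot : ae (volume.restrict ω) = ⊥ := eventually_false_iff_eq_bot.1 hf.2.2
      rw [ae_eq_bot, Measure.restrict_eq_zero] at hbot
      exact (hω.measure_eq_zero_iff volume).1 hbot
    exact ⟨0, measurable_const, by simp [hω0], by simp [hω0, EventuallyEq]⟩
  · obtain ⟨g, hg, hgF, hfg⟩ := hf.1.aemeasurable.exists_ae_eq_range_subset hf.2.2 hF
    exact ⟨g, hg, fun x _ => hgF (mem_range_self x), hfg⟩

theorem eLpNorm_comp_sub_self_eq (hp : 0 < p) (hA : MeasurableSet A) (hAω : A ⊆ ω)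
    {P : (Fin n → ℝ) → Fin n → ℝ} (hPω : MapsTo P A ω) :
    eLpNorm (fun x => f (P x) - f x) (ENNReal.ofReal p) (volume.restrict A) =
      (∫⁻ x in A, localizedIncrement p ω f x (P x)) ^ (1 / p) := by
  rw [eLpNorm_eq_lintegral_rpow_enorm_toReal (by simpa using hp) ENNReal.ofReal_ne_top,
    ENNReal.toReal_ofReal hp.le]
  congr 1
  refine setLIntegral_congr_fun hA fun x hx => ?_
  rw [localizedIncrement_of_mem (hAω hx) (hPω hx), enorm_sub_rev]

theorem gagliardoEnergy_comp_sub_self_le (hp : 1 ≤ p) (hω : MeasurableSet ω) (hf : Measurable f)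
    (hA : MeasurableSet A) (hAω : A ⊆ ω) {P : (Fin n → ℝ) → Fin n → ℝ} (hP : Measurable P)
    (hPω : MapsTo P A ω) {δ : ℝ} (hδ : 0 < δ) {q : ℝ} (hq : q = n + s * p) {K : ℝ≥0∞}
    (hPK : ENNReal.ofReal δ ^ ((n : ℝ) - q) * (∫⁻ x in A, localizedIncrement p ω f x (P x)) +
      nearEnergy volume q δ A (fun x y => localizedIncrement p ω f (P x) (P y)) ≤ K) :
    gagliardoEnergy s p A (fun x => f (P x) - f x) ≤
      2 ^ (p - 1) * (2 * kernelTail (volume : Measure (Fin n → ℝ)) q 1 * K +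
        (nearEnergy volume q δ A (localizedIncrement p ω f) + K)) := by
  rw [gagliardoEnergy_eq_mul, ← hq]
  refine (setLIntegral_comp_sub_self_le hp hω hf hA hAω hP hPω q δ).trans ?_
  rw [kernelTail_eq volume q hδ, Module.finrank_fin_fun, mul_left_comm 2, mul_comm _ (2 * _),
    mul_assoc (2 * _)]
  gcongr
  · exact le_self_add.trans hPK
  · exact le_add_self.trans hPK

theorem sobolevNorm_comp_sub_self_le (hs : 0 ≤ s) (hp : 1 ≤ p) (hω : MeasurableSet ω)
    (hf : Measurable f) (hA : MeasurableSet A) (hAω : A ⊆ ω) {P : (Fin n → ℝ) → Fin n → ℝ}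
    (hP : Measurable P) (hPω : MapsTo P A ω) {δ : ℝ} (hδ : 0 < δ) (hδ1 : δ ≤ 1) {q : ℝ}
    (hq : q = n + s * p) {K : ℝ≥0∞}
    (hPK : ENNReal.ofReal δ ^ ((n : ℝ) - q) * (∫⁻ x in A, localizedIncrement p ω f x (P x)) +
      nearEnergy volume q δ A (fun x y => localizedIncrement p ω f (P x) (P y)) ≤ K) :
    sobolevNorm s p A (fun x => f (P x) - f x) ≤
      K ^ (1 / p) + (2 ^ (p - 1) * (2 * kernelTail (volume : Measure (Fin n → ℝ)) q 1 * K +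
        (nearEnergy volume q δ A (localizedIncrement p ω f) + K))) ^ (1 / p) := by
  have hp' : 0 < p := by linarith
  have hscale : 1 ≤ ENNReal.ofReal δ ^ ((n : ℝ) - q) := by
    rw [← neg_sub, ENNReal.rpow_neg, ENNReal.one_le_inv]
    exact ENNReal.rpow_le_one (by simpa using hδ1) (by linarith [mul_nonneg hs hp'.le])
  refine add_le_add ?_ (ENNReal.rpow_le_rpow
    (gagliardoEnergy_comp_sub_self_le hp hω hf hA hAω hP hPω hδ hq hPK) (by positivity))
  rw [eLpNorm_comp_sub_self_eq hp' hA hAω hPω]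
  exact ENNReal.rpow_le_rpow ((le_mul_of_one_le_left zero_le hscale).trans
    (le_self_add.trans hPK)) (by positivity)

theorem exists_sobolevNorm_comp_meshRetraction_sub_le (hs : 0 < s) (hp : 1 ≤ p)
    (hω : MeasurableSet ω) (hf : Measurable f) {j : ℕ} (hj : j < n) (hsp : s * p < j + 1) :
    ∃ B : ℝ≥0∞, B ≠ ∞ ∧ ∀ δ : ℝ, 0 < δ → δ ≤ 1 → ∀ A, MeasurableSet A →
      (∀ x ∈ A, Metric.ball x (4 * δ) ⊆ ω) → ∃ τ : Fin n → ℝ,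
        sobolevNorm s p A (fun x => f (meshRetraction j δ τ x) - f x) ≤
          B * nearEnergy volume (n + s * p) (4 * δ) univ (localizedIncrement p ω f) ^ (1 / p) := by
  have hip : 0 ≤ 1 / p := by positivity
  have hM : (2 : ℝ≥0∞) ^ (p - 1) ≠ ∞ :=
    ENNReal.rpow_ne_top_of_nonneg (by linarith) ENNReal.ofNat_ne_top
  obtain ⟨q, hq⟩ : ∃ q : ℝ, q = n + s * p := ⟨_, rfl⟩
  have hnq : (n : ℝ) < q := by linarith [mul_pos hs (by linarith : 0 < p)]
  obtain ⟨K, hK, henergy⟩ := exists_meshRetraction_energy_le (ι := Fin n) (j := j) (q := q)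
    (by simpa using hj) (measurable_localizedIncrement hω hf) hM
    (quasiTriangle_localizedIncrement (f := f) hp) (by simpa using hnq)
    (by rw [Fintype.card_fin]; linarith)
  have hkernel : kernelTail (volume : Measure (Fin n → ℝ)) q 1 ≠ ∞ :=
    (kernelTail_one_lt_top volume (by simpa using hnq)).ne
  set κ := kernelTail (volume : Measure (Fin n → ℝ)) q 1
  refine ⟨K ^ (1 / p) + (2 ^ (p - 1) * (2 * κ * K + (1 + K))) ^ (1 / p), by finiteness,
    fun δ hδ hδ1 A hA hAω => ?_⟩
  obtain ⟨τ, hτ⟩ := henergy δ hδ A hA hAω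
  rw [Fintype.card_fin] at hτ
  refine ⟨τ, (sobolevNorm_comp_sub_self_le hs.le hp hω hf hA
    (fun x hx => hAω x hx (Metric.mem_ball_self (by linarith)))
    ((measurable_meshRetraction j δ).comp measurable_prodMk_left)
    (mapsTo_meshRetraction hδ τ hAω) hδ hδ1 hq hτ).trans ?_⟩
  rw [← hq, add_mul, ← ENNReal.mul_rpow_of_nonneg _ _ hip, ← ENNReal.mul_rpow_of_nonneg _ _ hip]
  set J := nearEnergy volume q (4 * δ) univ (localizedIncrement p ω f)
  have hJ : nearEnergy volume q δ A (localizedIncrement p ω f) ≤ J :=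
    (nearEnergy_mono_radius q (by linarith) A).trans (lintegral_mono_set (subset_univ A))
  refine add_le_add le_rfl (ENNReal.rpow_le_rpow ?_ hip)
  calc _ ≤ 2 ^ (p - 1) * (2 * κ * (K * J) + (J + K * J)) := by gcongr
    _ = _ := by ring

theorem tendsto_nearEnergy_localizedIncrement (hp : 0 < p) (hn : 0 < n) (hω : MeasurableSet ω)
    (hf : Measurable f) (hfin : sobolevNorm s p ω f < ∞) :
    Tendsto (fun δ => nearEnergy volume (n + s * p) δ univ (localizedIncrement p ω f))
      (𝓝[>] 0) (𝓝 0) := by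
  have : Nonempty (Fin n) := ⟨⟨0, hn⟩⟩
  refine tendsto_nearEnergy_univ (measurable_localizedIncrement hω hf) ?_
  rw [lintegral_localizedIncrement_mul volume hω, ← gagliardoEnergy_eq_mul]
  exact (gagliardoEnergy_lt_top_of_sobolevNorm_lt_top hp hfin).ne

end Sobolev

section Approximation

variable {n m : ℕ} {s p : ℝ} {Ω ω : Set (Fin n → ℝ)} {F : Set (EuclideanSpace ℝ (Fin m))}
  {f : (Fin n → ℝ) → EuclideanSpace ℝ (Fin m)} {j : ℕ}

theorem memSobolev_comp_meshRetraction (hp : 1 ≤ p) (hf : Measurable f)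
    (hfin : sobolevNorm s p ω f < ∞) (hfF : MapsTo f ω F) {A : Set (Fin n → ℝ)}
    (hA : MeasurableSet A) {δ : ℝ} (hδ : 0 < δ) (hAω : ∀ x ∈ A, Metric.ball x (4 * δ) ⊆ ω)
    {τ : Fin n → ℝ} (hτ : sobolevNorm s p A (fun x => f (meshRetraction j δ τ x) - f x) < ∞) :
    MapsTo (fun x => f (meshRetraction j δ τ x)) A F ∧
      MemSobolev s p A F fun x => f (meshRetraction j δ τ x) := by
  have hm : Measurable fun x => f (meshRetraction j δ τ x) :=
    hf.comp ((measurable_meshRetraction j δ).comp measurable_prodMk_left)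
  have hmaps : MapsTo (fun x => f (meshRetraction j δ τ x)) A F := fun x hx =>
    hfF (mapsTo_meshRetraction hδ τ hAω hx)
  refine ⟨hmaps, hm.aestronglyMeasurable, ?_, ae_restrict_of_forall_mem hA hmaps⟩
  have hA' : A ⊆ ω := fun x hx => hAω x hx (Metric.mem_ball_self (by linarith))
  simpa only [Pi.sub_apply, sub_add_cancel] using
    sobolevNorm_add_lt_top hp (hm.sub hf) hf.aestronglyMeasurable hτ
      ((sobolevNorm_mono (by linarith) hA').trans_lt hfin)

theorem exists_sobolevNorm_meshRetraction_sub_lt (hs : 0 < s) (hp : 1 ≤ p) (hj : j < n)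
    (hsp : s * p < j + 1) (hω : MeasurableSet ω) (hf : Measurable f)
    (hfin : sobolevNorm s p ω f < ∞) {η : ℝ} (hη : 0 < η) {e : ℝ≥0∞} (he : 0 < e) :
    ∃ δ, 0 < δ ∧ 4 * δ ≤ η ∧ ∀ A, MeasurableSet A → (∀ x ∈ A, Metric.ball x (4 * δ) ⊆ ω) →
      ∃ τ, sobolevNorm s p A (fun x => f (meshRetraction j δ τ x) - f x) < e := by
  have hp' : 0 < p := by linarith
  obtain ⟨B, hB, happrox⟩ := exists_sobolevNorm_comp_meshRetraction_sub_le hs hp hω hf hj hsp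
  have hsmall : Tendsto (fun R => B * nearEnergy volume (n + s * p) R univ
      (localizedIncrement p ω f) ^ (1 / p)) (𝓝[>] 0) (𝓝 0) := by
    have henergy := tendsto_nearEnergy_localizedIncrement hp' (by omega) hω hf hfin
    simpa [ENNReal.zero_rpow_of_pos (inv_pos.2 hp')] using
      ENNReal.Tendsto.const_mul (henergy.ennrpow_const (1 / p)) (Or.inr hB)
  obtain ⟨δ, hδe, hδ, hδη⟩ := ((eventually_nhdsGT_zero_mul_left four_pos
    (hsmall.eventually_lt_const he)).and
      (Ioc_mem_nhdsGT (by positivity : 0 < min 1 (η / 4)))).exists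
  rw [le_min_iff] at hδη
  refine ⟨δ, hδ, by linarith, fun A hA hAω => ?_⟩
  obtain ⟨τ, hτ⟩ := happrox δ hδ hδη.1 A hA hAω
  exact ⟨τ, hτ.trans_lt hδe⟩

theorem exists_isPiecewiseHomogeneous_sobolevNorm_sub_lt (hs : 0 < s) (hp : 1 ≤ p) (hω : IsOpen ω)
    (hΩ : Bornology.IsBounded Ω) (hΩω : closure Ω ⊆ ω) (hf : MemSobolev s p ω F f)
    (hj : j < n) (hsp : s * p < j + 1) {e : ℝ≥0∞} (he : 0 < e) :
    ∃ (C : CubicMesh n) (g : (Fin n → ℝ) → EuclideanSpace ℝ (Fin m)),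
      closure Ω ⊆ C.carrier ∧ C.carrier ⊆ ω ∧ MapsTo g C.carrier F ∧
        C.IsPiecewiseHomogeneous j g ∧ MemSobolev s p C.carrier F g ∧
        sobolevNorm s p Ω (fun x => g x - f x) < e := by
  obtain ⟨f', hf', hf'F, hff'⟩ := hf.exists_measurable_mapsTo hω
  have hfin : sobolevNorm s p ω f' < ∞ := sobolevNorm_congr hff' ▸ hf.2.1
  obtain ⟨η, hη, hηω⟩ := hΩ.isCompact_closure.exists_thickening_subset_open hω hΩω
  obtain ⟨δ, hδ, hδη, hδe⟩ := exists_sobolevNorm_meshRetraction_sub_lt hs hp hj hsp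
    hω.measurableSet hf' hfin (half_pos hη) he
  set A := Metric.thickening (η / 2) (closure Ω)
  have hA : MeasurableSet A := Metric.isOpen_thickening.measurableSet
  have hAω : ∀ x ∈ A, Metric.ball x (4 * δ) ⊆ ω := fun x hx y hy => by
    refine hηω (add_halves η ▸ Metric.thickening_thickening_subset _ _ _ ?_)
    exact Metric.mem_thickening_iff.2 ⟨x, hx, (Metric.mem_ball.1 hy).trans_le hδη⟩
  have hAω' : A ⊆ ω := fun x hx => hAω x hx (Metric.mem_ball_self (by linarith))
  obtain ⟨τ, hτ⟩ := hδe A hA hAω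
  obtain ⟨C, hCT, hCε, hΩC, hCΩ⟩ := CubicMesh.exists_cover (-(δ • τ)) (half_pos hδ) hΩ.closure
  have hCA : C.carrier ⊆ A := fun x hx => by
    obtain ⟨y, hy, hxy⟩ := hCΩ x hx
    exact Metric.mem_thickening_iff.2 ⟨y, hy, by rw [dist_eq_norm]; linarith⟩
  have hΩA : Ω ⊆ A := subset_closure.trans (hΩC.trans hCA)
  obtain ⟨hmaps, hmem⟩ := memSobolev_comp_meshRetraction hp hf' hfin hf'F hA hδ hAω
    (hτ.trans_le le_top)
  refine ⟨C, fun x => f' (meshRetraction j δ τ x), hΩC, hCA.trans hAω', hmaps.mono_left hCA,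
    C.isPiecewiseHomogeneous_comp_meshRetraction hCT (by rw [hCε]; ring) f',
    hmem.mono (by linarith) hCA, ?_⟩
  refine (sobolevNorm_congr ?_).trans_lt ((sobolevNorm_mono (by linarith) hΩA).trans_lt hτ)
  filter_upwards [ae_restrict_of_ae_restrict_of_subset (hΩA.trans hAω') hff'] with x hx
  rw [hx]

end Approximation

theorem theorem1p5_general {n m : ℕ} (F : Set (EuclideanSpace ℝ (Fin m))) (s p : ℝ)
    (hs0 : 0 < s) (hp : 1 ≤ p) (Ω ω : Set (Fin n → ℝ)) (hω : IsOpen ω)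
    (hΩb : Bornology.IsBounded Ω) (hΩω : closure Ω ⊆ ω)
    (f : (Fin n → ℝ) → EuclideanSpace ℝ (Fin m)) (hf : MemSobolev s p ω F f)
    (j : ℕ) (hj : ⌊s * p⌋₊ ≤ j) (hjn : j < n) :
    ∃ (C : ℕ → CubicMesh n) (fk : ℕ → (Fin n → ℝ) → EuclideanSpace ℝ (Fin m)),
      (∀ k, closure Ω ⊆ (C k).carrier ∧ (C k).carrier ⊆ ω) ∧
      (∀ k, ∀ x ∈ (C k).carrier, fk k x ∈ F) ∧
      (∀ k, (C k).IsPiecewiseHomogeneous j (fk k)) ∧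
      (∀ k, MemSobolev s p (C k).carrier F (fk k)) ∧
      Tendsto (fun k => sobolevNorm s p Ω (fun x => fk k x - f x)) atTop (𝓝 0) := by
  have hsp : s * p < j + 1 := by exact_mod_cast Nat.lt_of_floor_lt (Nat.lt_succ_of_le hj)
  have happrox (k : ℕ) := exists_isPiecewiseHomogeneous_sobolevNorm_sub_lt hs0 hp hω hΩb hΩω hf
    hjn hsp (e := (k : ℝ≥0∞)⁻¹) (ENNReal.inv_pos.2 (ENNReal.natCast_ne_top k))
  choose C fk hΩC hCω hF hhom hmem hlt using happrox
  exact ⟨C, fk, fun k => ⟨hΩC k, hCω k⟩, hF, hhom, hmem, tendsto_of_tendsto_of_tendsto_of_le_of_le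
    tendsto_const_nhds ENNReal.tendsto_inv_nat_nhds_zero (fun _ => zero_le) fun k => (hlt k).le⟩

theorem theorem1p5 {n m : ℕ} (F : Set (EuclideanSpace ℝ (Fin m))) (s p : ℝ)
    (hs0 : 0 < s) (hs1 : s < 1) (hp : 1 ≤ p) (hspn : s * p < n)
    (Ω ω : Set (Fin n → ℝ)) (hΩ : IsSmoothOpen Ω) (hω : IsSmoothOpen ω)
    (hΩb : Bornology.IsBounded Ω) (hωb : Bornology.IsBounded ω) (hΩω : closure Ω ⊆ ω)
    (f : (Fin n → ℝ) → EuclideanSpace ℝ (Fin m)) (hf : MemSobolev s p ω F f)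
    (j : ℕ) (hj : ⌊s * p⌋₊ ≤ j) (hjn : j < n) :
    ∃ (C : ℕ → CubicMesh n) (fk : ℕ → (Fin n → ℝ) → EuclideanSpace ℝ (Fin m)),
      (∀ k, closure Ω ⊆ (C k).carrier ∧ (C k).carrier ⊆ ω) ∧
      (∀ k, ∀ x ∈ (C k).carrier, fk k x ∈ F) ∧
      (∀ k, (C k).IsPiecewiseHomogeneous j (fk k)) ∧
      (∀ k, MemSobolev s p (C k).carrier F (fk k)) ∧
      Tendsto (fun k => sobolevNorm s p Ω (fun x => fk k x - f x)) atTop (𝓝 0) :=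
  theorem1p5_general F s p hs0 hp Ω ω hω.1 hΩb hΩω f hf j hj hjn
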